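/- Let $\mathbb{D}=\{z\in\mathbb{C}:|z|<1\}$. For $-1/2\le\alpha<0$ let $\mathcal{F}(\alpha)$ be the class of functions $f$ analytic in $\mathbb{D}$ with $f(0)=0$, $f'(0)=1$, $f'\neq 0$ in $\mathbb{D}$ and $$\operatorname{Re}\left(1+\frac{zf''(z)}{f'(z)}\right)>\alpha\qquad(z\in\mathbb{D}).$$ For $z_1,z_2\in\mathbb{D}$ let $$\rho(z_1,z_2)=\left|\frac{z_1-z_2}{1-\overline{z_1}z_2}\right|,\qquad \lambda(z_1,z_2)=\frac12\log\frac{1+\rho(z_1,z_2)}{1-\rho(z_1,z_2)},$$ and $$\Delta_f(z_1,z_2)=\frac{|f(z_1)-f(z_2)|}{\sqrt{(1-|z_1|^2)|f'(z_1)|\,(1-|z_2|^2)|f'(z_2)|}}.$$ Let $-1/2\le\alpha<0$. Then for every $f\in\mathcal{F}(\alpha)$ $$\Delta_f(z_1,z_2)\ge\sqrt{\frac{1+\alpha}{-2\alpha}}\,\sin\left(\sqrt{\frac{-2\alpha}{1+\alpha}}\;\lambda(z_1,z_2)\right)$$ for all $z_1,z_2\in\mathbb{D}$ with $\lambda(z_1,z_2)\le\pi\sqrt{(1+\alpha)/(-2\alpha)}$,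 and $$\Delta_f(z_1,z_2)\le\sqrt{\frac{1+\alpha}{2}}\,\sinh\left(\sqrt{\frac{2}{1+\alpha}}\;\lambda(z_1,z_2)\right)$$ for all $z_1,z_2\in\mathbb{D}$. Both inequalities are sharp, in the sense that their constants are best possible for the class $\mathcal{F}(\alpha)$, even for pairs of points that are arbitrarily close: for every $0<\delta<\sqrt{-2\alpha/(1+\alpha)}$ and every $\varepsilon>0$ there are $f\in\mathcal{F}(\alpha)$ and $z_1,z_2\in\mathbb{D}$ with $\lambda(z_1,z_2)<\varepsilon$ and $$\Delta_f(z_1,z_2)<\frac1\delta\sin\bigl(\delta\lambda(z_1,z_2)\bigr),$$ and for every $0<\kappa<\sqrt{2/(1+\alpha)}$ and every $\varepsilon>0$ there are $f\in\mathcal{F}(\alpha)$ and $z_1,z_2\in\mathbb{D}$ with $\lambda(z_1,z_2)<\varepsilon$ and $$\Delta_f(z_1,z_2)>\frac1\kappa\sinh\bigl(\kappa\lambda(z_1,z_2)\bigr).$$ -/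

import Mathlib

open scoped ComplexConjugate

noncomputable section

/-- The open unit disk of the complex plane. -/
def unitDisk : Set ℂ := Metric.ball (0 : ℂ) 1

/-- The class of functions analytic in the unit disk, normalized by `f 0 = 0`, `f' 0 = 1`. -/
def classA : Set (ℂ → ℂ) :=
  {f | DifferentiableOn ℂ f unitDisk ∧ f 0 = 0 ∧ deriv f 0 = 1}

/-- The class of those normalized analytic functions, with nowhere vanishing derivative, that satisfy
`Re (1 + z f'' z / f' z) > α` throughout the unit disk. -/
def classF (α : ℝ) : Set (ℂ → ℂ) :=
  {f | f ∈ classA ∧ (∀ z ∈ unitDisk, deriv f z ≠ 0) ∧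
    ∀ z ∈ unitDisk, α < (1 + z * deriv (deriv f) z / deriv f z).re}

/-- The pseudo-hyperbolic distance. -/
def pseudoHypDist (z₁ z₂ : ℂ) : ℝ := ‖(z₁ - z₂) / (1 - conj z₁ * z₂)‖

/-- The hyperbolic distance of the unit disk, for the metric `|dz| / (1 - |z|²)`. -/
def hypDist (z₁ z₂ : ℂ) : ℝ :=
  1 / 2 * Real.log ((1 + pseudoHypDist z₁ z₂) / (1 - pseudoHypDist z₁ z₂))

/-- The two-point distortion quantity
`|f z₁ - f z₂| / √((1 - |z₁|²)|f' z₁| (1 - |z₂|²)|f' z₂|)`. -/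
def twoPointDistortion (f : ℂ → ℂ) (z₁ z₂ : ℂ) : ℝ :=
  ‖f z₁ - f z₂‖ /
    √(((1 - ‖z₁‖ ^ 2) * ‖deriv f z₁‖) * ((1 - ‖z₂‖ ^ 2) * ‖deriv f z₂‖))

end

/-!
Along a unit-speed hyperbolic geodesic `γ` from `z₁`, the function `(f - f z₁) / √f'`, divided by
`√γ'` and suitably normalized, solves `v'' = (1 - S_f(γ) γ'² / 2) v` with `v 0 = 0`, `v' 0 = 1`,
where `S_f` is the Schwarzian derivative, and its norm is the two-point distortion of `f`. Since
`|γ'| = 1 - |γ|²`, a bound on `(1 - |z|²)² |S_f z|` confines the coefficient to a disk around `1`: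
comparison with `v'' = κ² v` bounds `‖v‖` above by a `sinh`, and a Sturm comparison with
`v'' = -δ² v` bounds it below by a `sin`.

For `f` in `classF α` the function `f'' / f'` is `2 (1 - α) φ / (1 - z φ)` with `|φ| ≤ 1`, and then
`S_f = 2 (1 - α) (φ' + α φ²) / (1 - z φ)²`. The Schwarz–Pick inequality for `φ` yields
`(1 - |z|²)² |S_f z| ≤ 2 (1 - α) / (1 + α)`, which is approached when `φ` is a disk automorphism.

The solution `v` and the two bounds have the form `t + c t³ / 6 + o(t³)`, where `c` is the
coefficient of the equation at `t = 0`. If `(1 - |z₁|²)² |S_f z₁|` is too large for `κ` or `δ`, then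
the geodesic direction in which `S_f γ'²` is negative, respectively positive, at `z₁` violates the
corresponding bound near `z₁`.
-/

open Set Filter Topology Asymptotics RealInnerProductSpace

section Comparison

variable {E : Type*} [NormedAddCommGroup E] [NormedSpace ℝ E] {v v' v'' : ℝ → E}
  {B B' B'' : ℝ → ℝ} {a b κ : ℝ}

theorem norm_le_of_norm_deriv_deriv_le (hv : ∀ t, HasDerivAt v (v' t) t)
    (hv' : ∀ t, HasDerivAt v' (v'' t) t) (hB : ∀ t, HasDerivAt B (B' t) t)
    (hB' : ∀ t, HasDerivAt B' (B'' t) t) (h : ‖v a‖ ≤ B a) (h' : ‖v' a‖ ≤ B' a)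
    (bound : ∀ t ∈ Icc a b, ‖v'' t‖ ≤ B'' t) : ∀ t ∈ Icc a b, ‖v t‖ ≤ B t := by
  have first_order : ∀ t ∈ Icc a b, ‖v' t‖ ≤ B' t :=
    image_norm_le_of_norm_deriv_right_le_deriv_boundary
      (fun t _ => (hv' t).continuousAt.continuousWithinAt) (fun t _ => (hv' t).hasDerivWithinAt)
      h' hB' fun t ht => bound t (Ico_subset_Icc_self ht)
  exact image_norm_le_of_norm_deriv_right_le_deriv_boundary
    (fun t _ => (hv t).continuousAt.continuousWithinAt) (fun t _ => (hv t).hasDerivWithinAt)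
    h hB fun t ht => first_order t (Ico_subset_Icc_self ht)

-- Each application of the previous lemma divides the error term `C exp (2 κ (t - a))` by `4`.
theorem norm_le_of_norm_deriv_deriv_le_mul (hv : ∀ t, HasDerivAt v (v' t) t)
    (hv' : ∀ t, HasDerivAt v' (v'' t) t) (hB : ∀ t, HasDerivAt B (B' t) t)
    (hB' : ∀ t, HasDerivAt B' (B'' t) t) (h : ‖v a‖ ≤ B a) (h' : ‖v' a‖ ≤ B' a) (hκ : 0 ≤ κ)
    (bound : ∀ t ∈ Icc a b, ‖v'' t‖ ≤ κ ^ 2 * ‖v t‖)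
    (super : ∀ t ∈ Icc a b, κ ^ 2 * B t ≤ B'' t) : ∀ t ∈ Icc a b, ‖v t‖ ≤ B t := by
  obtain ⟨C, hC⟩ := isCompact_Icc.exists_bound_of_continuousOn (f := fun t => ‖v t‖ - B t)
    (s := Icc a b) fun t _ =>
      ((hv t).continuousAt.norm.sub (hB t).continuousAt).continuousWithinAt
  rintro t ht
  have hC0 : 0 ≤ C := (norm_nonneg _).trans (hC t ht)
  set e : ℝ → ℝ := fun t => Real.exp (2 * κ * (t - a))
  have he : ∀ t, HasDerivAt e (2 * κ * e t) t := fun t =>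
    (((hasDerivAt_id t).sub_const a).const_mul (2 * κ)).exp.congr_deriv (by simp [e]; ring)
  have contraction : ∀ n : ℕ, ∀ t ∈ Icc a b, ‖v t‖ ≤ B t + C / 4 ^ n * e t := by
    intro n
    induction n with
    | zero =>
      intro t ht
      have one_le : 1 ≤ e t := Real.one_le_exp (by nlinarith [ht.1])
      have := (le_abs_self _).trans (hC t ht)
      simp only [pow_zero, div_one]
      nlinarith
    | succ n ih =>
      refine norm_le_of_norm_deriv_deriv_le hv hv'
        (fun t => (hB t).add ((he t).const_mul (C / 4 ^ (n + 1))))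
        (fun t => (hB' t).add (((he t).const_mul (2 * κ)).const_mul (C / 4 ^ (n + 1))))
        (h.trans <| le_add_of_nonneg_right <| by positivity)
        (h'.trans <| le_add_of_nonneg_right <| by positivity) fun t ht => ?_
      calc ‖v'' t‖
          ≤ κ ^ 2 * (B t + C / 4 ^ n * e t) := (bound t ht).trans (by gcongr; exact ih t ht)
        _ ≤ B'' t + κ ^ 2 * (C / 4 ^ n * e t) := by linarith [super t ht]
        _ = B'' t + C / 4 ^ (n + 1) * (2 * κ * (2 * κ * e t)) := by ring
  have limit : Tendsto (fun n : ℕ => B t + C / 4 ^ n * e t) atTop (𝓝 (B t)) := by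
    have pow_lim : Tendsto (fun n : ℕ => (4⁻¹ : ℝ) ^ n) atTop (𝓝 0) :=
      tendsto_pow_atTop_nhds_zero_of_lt_one (by norm_num) (by norm_num)
    simpa [div_eq_mul_inv] using ((pow_lim.const_mul C).mul_const (e t)).const_add (B t)
  exact ge_of_tendsto' limit fun n => contraction n t ht

theorem hasDerivAt_sinh_mul_div (hκ : κ ≠ 0) (t : ℝ) :
    HasDerivAt (fun t => Real.sinh (κ * t) / κ) (Real.cosh (κ * t)) t :=
  ((((hasDerivAt_id t).const_mul κ).sinh).div_const κ).congr_deriv (by simp; field_simp)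

theorem hasDerivAt_cosh_mul (hκ : κ ≠ 0) (t : ℝ) :
    HasDerivAt (fun t => Real.cosh (κ * t)) (κ ^ 2 * (Real.sinh (κ * t) / κ)) t :=
  ((hasDerivAt_id t).const_mul κ).cosh.congr_deriv (by simp; field_simp)

theorem hasDerivAt_sin_mul_div (hκ : κ ≠ 0) (t : ℝ) :
    HasDerivAt (fun t => Real.sin (κ * t) / κ) (Real.cos (κ * t)) t :=
  ((((hasDerivAt_id t).const_mul κ).sin).div_const κ).congr_deriv (by simp; field_simp)

theorem hasDerivAt_cos_mul (hκ : κ ≠ 0) (t : ℝ) :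
    HasDerivAt (fun t => Real.cos (κ * t)) (-κ ^ 2 * (Real.sin (κ * t) / κ)) t :=
  ((hasDerivAt_id t).const_mul κ).cos.congr_deriv (by simp; field_simp)

theorem norm_le_mul_sinh_of_norm_deriv_deriv_le (hv : ∀ t, HasDerivAt v (v' t) t)
    (hv' : ∀ t, HasDerivAt v' (v'' t) t) (h0 : v 0 = 0) (hκ : 0 < κ)
    (bound : ∀ t, ‖v'' t‖ ≤ κ ^ 2 * ‖v t‖) {t : ℝ} (ht : 0 ≤ t) :
    ‖v t‖ ≤ ‖v' 0‖ * (Real.sinh (κ * t) / κ) :=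
  norm_le_of_norm_deriv_deriv_le_mul (a := 0) (b := t) hv hv'
    (fun s => (hasDerivAt_sinh_mul_div hκ.ne' s).const_mul ‖v' 0‖)
    (fun s => (hasDerivAt_cosh_mul hκ.ne' s).const_mul ‖v' 0‖) (by simp [h0]) (by simp) hκ.le
    (fun s _ => bound s) (fun s _ => (mul_left_comm ..).le) t ⟨ht, le_rfl⟩

theorem tendsto_inv_smul_of_hasDerivAt {w : E} (hv : HasDerivAt v w 0) (h0 : v 0 = 0) :
    Tendsto (fun t : ℝ => t⁻¹ • v t) (𝓝[>] 0) (𝓝 w) := by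
  simpa [h0] using hv.tendsto_slope_zero_right

theorem le_of_tendsto_nhdsGT_of_deriv_nonneg {f f' : ℝ → ℝ} {l : ℝ}
    (hf : ∀ t ∈ Ioc a b, HasDerivAt f (f' t) t) (nonneg : ∀ t ∈ Ioc a b, 0 ≤ f' t)
    (hl : Tendsto f (𝓝[>] a) (𝓝 l)) {t : ℝ} (ht : t ∈ Ioc a b) : l ≤ f t := by
  have mono : MonotoneOn f (Ioc a b) := monotoneOn_of_hasDerivWithinAt_nonneg (convex_Ioc a b)
    (fun x hx => (hf x hx).continuousAt.continuousWithinAt)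
    (fun x hx => (hf x (interior_subset hx)).hasDerivWithinAt)
    fun x hx => nonneg x (interior_subset hx)
  refine le_of_tendsto hl ?_
  filter_upwards [Ioc_mem_nhdsGT ht.1] with x hx
  exact mono ⟨hx.1, hx.2.trans ht.2⟩ ht hx.2

end Comparison

section Sturm

variable {E : Type*} [NormedAddCommGroup E] [InnerProductSpace ℝ E] {v v' v'' : ℝ → E}
  {s s' k : ℝ → ℝ} {L : ℝ}

-- With the Wronskian `W = s v' - s' v`, the quotient `u = v / s` satisfies `u' = W / s²`, and
-- `⟪u, W⟫` increases from `0`; hence `‖u‖` increases from `‖v' 0‖`.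
theorem norm_deriv_mul_le_norm_of_sturm (hv : ∀ t, HasDerivAt v (v' t) t)
    (hv' : ∀ t, HasDerivAt v' (v'' t) t) (hv0 : v 0 = 0) (hs : ∀ t, HasDerivAt s (s' t) t)
    (hs' : ∀ t, HasDerivAt s' (k t * s t) t) (hs0 : s 0 = 0) (hs1 : s' 0 = 1)
    (hk : ∀ t ∈ Ioc 0 L, k t * ‖v t‖ ^ 2 ≤ ⟪v t, v'' t⟫)
    (hpos : ∀ t ∈ Ioc 0 L, 0 < s t) (hL : 0 < L) : ‖v' 0‖ * s L ≤ ‖v L‖ := by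
  set W : ℝ → E := fun t => s t • v' t - s' t • v t
  set u : ℝ → E := fun t => (s t)⁻¹ • v t
  have hW : ∀ t, HasDerivAt W (s t • (v'' t - k t • v t)) t := fun t =>
    (((hs t).smul (hv' t)).sub ((hs' t).smul (hv t))).congr_deriv (by module)
  have hu : ∀ t ∈ Ioc 0 L, HasDerivAt u ((s t ^ 2)⁻¹ • W t) t := fun t ht => by
    have := (hpos t ht).ne'
    refine (((hs t).inv this).smul (hv t)).congr_deriv ?_
    simp only [W, Pi.inv_apply]
    match_scalars <;> field_simp
  have u_lim : Tendsto u (𝓝[>] 0) (𝓝 (v' 0)) := by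
    have ratio := ((tendsto_inv_smul_of_hasDerivAt (hs 0) hs0).inv₀ (hs1 ▸ one_ne_zero)).smul
      (tendsto_inv_smul_of_hasDerivAt (hv 0) hv0)
    rw [hs1, inv_one, one_smul] at ratio
    refine ratio.congr' ?_
    filter_upwards [self_mem_nhdsWithin] with t (ht : 0 < t)
    simp only [u, smul_eq_mul, smul_smul]
    congr 1
    field_simp
  have W_lim : Tendsto W (𝓝[>] 0) (𝓝 0) := by
    simpa [W, hs0, hv0] using (hW 0).continuousAt.tendsto.mono_left nhdsWithin_le_nhds
  have inner_nonneg : ∀ t ∈ Ioc 0 L, 0 ≤ ⟪u t, W t⟫ := fun t ht =>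
    le_of_tendsto_nhdsGT_of_deriv_nonneg (f := fun t => ⟪u t, W t⟫)
      (f' := fun t => (s t ^ 2)⁻¹ * ‖W t‖ ^ 2 + (⟪v t, v'' t⟫ - k t * ‖v t‖ ^ 2))
      (fun t ht => ((hu t ht).inner ℝ (hW t)).congr_deriv <| by
        have := (hpos t ht).ne'
        simp only [u, real_inner_smul_left, real_inner_smul_right, inner_sub_right,
          real_inner_self_eq_norm_sq]
        field_simp
        ring)
      (fun t ht => add_nonneg (by positivity) (sub_nonneg.2 (hk t ht)))
      (by simpa using u_lim.inner W_lim) ht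
  have norm_u_sq : ‖v' 0‖ ^ 2 ≤ ‖u L‖ ^ 2 :=
    le_of_tendsto_nhdsGT_of_deriv_nonneg (f := fun t => ‖u t‖ ^ 2)
      (fun t ht => (hu t ht).norm_sq)
      (fun t ht => by
        rw [real_inner_smul_right]
        have := inner_nonneg t ht
        positivity)
      (u_lim.norm.pow 2) ⟨hL, le_rfl⟩
  have sL := hpos L ⟨hL, le_rfl⟩
  rw [sq_le_sq₀ (norm_nonneg _) (norm_nonneg _), norm_smul, norm_inv, Real.norm_of_nonneg sL.le,
    ← div_eq_inv_mul, le_div_iff₀ sL] at norm_u_sq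
  exact norm_u_sq

theorem norm_deriv_mul_sin_le_norm {κ : ℝ} (hv : ∀ t, HasDerivAt v (v' t) t)
    (hv' : ∀ t, HasDerivAt v' (v'' t) t) (hv0 : v 0 = 0) (hκ : 0 < κ)
    (hk : ∀ t, -κ ^ 2 * ‖v t‖ ^ 2 ≤ ⟪v t, v'' t⟫) {t : ℝ} (ht : 0 ≤ t) (htπ : κ * t ≤ Real.pi) :
    ‖v' 0‖ * (Real.sin (κ * t) / κ) ≤ ‖v t‖ := by
  rcases ht.eq_or_lt with rfl | ht
  · simp
  rcases htπ.eq_or_lt with htπ | htπ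
  · simp [htπ]
  refine norm_deriv_mul_le_norm_of_sturm hv hv' hv0 (hasDerivAt_sin_mul_div hκ.ne')
    (hasDerivAt_cos_mul hκ.ne') (by simp) (by simp) (fun s _ => hk s) (fun s hs => ?_) ht
  exact div_pos (Real.sin_pos_of_pos_of_lt_pi (mul_pos hκ hs.1)
    ((mul_le_mul_of_nonneg_left hs.2 hκ.le).trans_lt htπ)) hκ

end Sturm

section CubicExpansion

variable {E F : Type*} [NormedAddCommGroup E] [NormedSpace ℝ E] [NormedAddCommGroup F]
  [NormedSpace ℝ F] {v v' v'' : ℝ → E} {u u' u'' : ℝ → F} {k l : ℝ}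

theorem isLittleO_sub_cubic {w : E} (hv : ∀ t, HasDerivAt v (v' t) t)
    (hv' : ∀ t, HasDerivAt v' (v'' t) t) (h0 : v 0 = 0) (h0'' : v'' 0 = 0)
    (hw : HasDerivAt v'' w 0) :
    (fun t => v t - (t • v' 0 + (t ^ 3 / 6) • w)) =o[𝓝 0] fun t => t ^ 3 := by
  have order₁ : (fun t => v'' t - t • w) =o[𝓝 0] fun t => (t - 0) ^ 1 := by
    simpa [h0''] using hw.isLittleO
  have hd₁ : ∀ t : ℝ, HasDerivAt (fun t => v' t - (t ^ 2 / 2) • w) (v'' t - t • w) t := fun t =>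
    ((hv' t).sub (((hasDerivAt_pow 2 t).div_const 2).smul_const w)).congr_deriv (by simp)
  have hd₀ : ∀ t : ℝ, HasDerivAt (fun t => v t - (t • v' 0 + (t ^ 3 / 6) • w))
      (v' t - (t ^ 2 / 2) • w - v' 0) t := fun t =>
    ((hv t).sub (((hasDerivAt_id t).smul_const (v' 0)).add
      (((hasDerivAt_pow 3 t).div_const 6).smul_const w))).congr_deriv (by push_cast; module)
  have order₂ := convex_univ.isLittleO_pow_succ_real (mem_univ (0 : ℝ))
    (fun t _ => (hd₁ t).hasDerivWithinAt) (by simpa only [nhdsWithin_univ] using order₁)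
  have order₃ := convex_univ.isLittleO_pow_succ_real (mem_univ (0 : ℝ)) (n := 2)
    (fun t _ => (hd₀ t).hasDerivWithinAt) (by simpa using order₂)
  simpa [h0] using order₃

theorem isLittleO_norm_sub_cubic (hv : ∀ t, HasDerivAt v (v' t) t)
    (hv' : ∀ t, HasDerivAt v' (v'' t) t) (h0 : v 0 = 0) (h0'' : v'' 0 = 0)
    (hk : HasDerivAt v'' (k • v' 0) 0) :
    (fun t => ‖v t‖ - (t + k / 6 * t ^ 3) * ‖v' 0‖) =o[𝓝[>] 0] fun t => t ^ 3 := by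
  have cubic := (isLittleO_sub_cubic hv hv' h0 h0'' hk).mono nhdsWithin_le_nhds (l := 𝓝[>] 0)
  refine IsBigO.trans_isLittleO (IsBigO.of_bound 1 ?_) cubic
  have pos : ∀ᶠ t : ℝ in 𝓝[>] 0, 0 < 1 + k / 6 * t ^ 2 :=
    nhdsWithin_le_nhds <| (by fun_prop : ContinuousAt (fun t : ℝ => 1 + k / 6 * t ^ 2) 0).eventually
      (lt_mem_nhds (by simp))
  filter_upwards [pos, self_mem_nhdsWithin] with t hpos (ht : 0 < t)
  have main_term : (t + k / 6 * t ^ 3) * ‖v' 0‖ = ‖t • v' 0 + (t ^ 3 / 6) • k • v' 0‖ := by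
    rw [smul_smul, ← add_smul, norm_smul, Real.norm_of_nonneg]
    · ring
    · nlinarith [mul_pos ht hpos]
  rw [main_term, one_mul]
  exact abs_norm_sub_norm_le _ _

theorem eventually_norm_lt_norm_of_cubic_lt (hv : ∀ t, HasDerivAt v (v' t) t)
    (hv' : ∀ t, HasDerivAt v' (v'' t) t) (hv0 : v 0 = 0) (hv0'' : v'' 0 = 0)
    (hk : HasDerivAt v'' (k • v' 0) 0) (hu : ∀ t, HasDerivAt u (u' t) t)
    (hu' : ∀ t, HasDerivAt u' (u'' t) t) (hu0 : u 0 = 0) (hu0'' : u'' 0 = 0)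
    (hl : HasDerivAt u'' (l • u' 0) 0) (hnorm : ‖v' 0‖ = 1) (hnorm' : ‖u' 0‖ = 1) (hkl : k < l) :
    ∀ᶠ t in 𝓝[>] 0, ‖v t‖ < ‖u t‖ := by
  have diff := (isLittleO_norm_sub_cubic hu hu' hu0 hu0'' hl).sub
    (isLittleO_norm_sub_cubic hv hv' hv0 hv0'' hk)
  filter_upwards [diff.bound (c := (l - k) / 12) (by linarith), self_mem_nhdsWithin]
    with t hle (ht : 0 < t)
  rw [hnorm, hnorm', Real.norm_of_nonneg (by positivity : 0 ≤ t ^ 3)] at hle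
  nlinarith [(abs_le.1 hle).1, mul_pos (sub_pos.2 hkl) (pow_pos ht 3)]

end CubicExpansion

theorem mem_unitDisk_iff {z : ℂ} : z ∈ unitDisk ↔ ‖z‖ < 1 := by simp [unitDisk]

theorem isOpen_unitDisk : IsOpen unitDisk := Metric.isOpen_ball

theorem neg_mem_unitDisk {z : ℂ} (hz : z ∈ unitDisk) : -z ∈ unitDisk := by
  simpa [mem_unitDisk_iff] using hz

theorem one_sub_normSq_pos {z : ℂ} (hz : z ∈ unitDisk) : 0 < 1 - ‖z‖ ^ 2 := by
  nlinarith [norm_nonneg z, mem_unitDisk_iff.1 hz]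

theorem norm_mul_lt_one_of_mem_unitDisk {z w : ℂ} (hz : z ∈ unitDisk) (hw : ‖w‖ ≤ 1) :
    ‖z * w‖ < 1 := by
  rw [norm_mul]
  exact mul_lt_one_of_nonneg_of_lt_one_left (norm_nonneg _) (mem_unitDisk_iff.1 hz) hw

theorem one_sub_mul_ne_zero {z w : ℂ} (hz : z ∈ unitDisk) (hw : ‖w‖ ≤ 1) : 1 - z * w ≠ 0 := by
  refine sub_ne_zero.2 fun h => ?_
  have := norm_mul_lt_one_of_mem_unitDisk hz hw
  simp [← h] at this

/-- The automorphism of the unit disk that sends `a` to `0` and has positive derivative there; its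
inverse is `diskAut (-a)`. -/
noncomputable def diskAut (a z : ℂ) : ℂ := (z - a) / (1 - conj a * z)

section DiskAut

variable {a z : ℂ}

theorem diskAut_self (a : ℂ) : diskAut a a = 0 := by simp [diskAut]

theorem diskAut_zero (a : ℂ) : diskAut a 0 = -a := by simp [diskAut]

theorem one_sub_conj_mul_ne_zero (ha : a ∈ unitDisk) (hz : z ∈ unitDisk) :
    1 - conj a * z ≠ 0 := by
  rw [mul_comm]
  exact one_sub_mul_ne_zero hz (by simpa using (mem_unitDisk_iff.1 ha).le)

theorem one_sub_conj_mul_self (a : ℂ) : 1 - conj a * a = ((1 - ‖a‖ ^ 2 : ℝ) : ℂ) := by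
  rw [Complex.conj_mul']; push_cast; rfl

theorem one_sub_normSq_diskAut (ha : a ∈ unitDisk) (hz : z ∈ unitDisk) :
    1 - ‖diskAut a z‖ ^ 2 = (1 - ‖a‖ ^ 2) * (1 - ‖z‖ ^ 2) / ‖1 - conj a * z‖ ^ 2 := by
  have hne := norm_ne_zero_iff.2 (one_sub_conj_mul_ne_zero ha hz)
  have identity : ‖1 - conj a * z‖ ^ 2 - ‖z - a‖ ^ 2 = (1 - ‖a‖ ^ 2) * (1 - ‖z‖ ^ 2) := by
    simp only [← Complex.normSq_eq_norm_sq, Complex.normSq_apply, Complex.sub_re, Complex.sub_im,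
      Complex.mul_re, Complex.mul_im, Complex.conj_re, Complex.conj_im, Complex.one_re,
      Complex.one_im]
    ring
  rw [← identity, diskAut, norm_div, div_pow, sub_div, div_self (pow_ne_zero 2 hne)]

theorem diskAut_mem_unitDisk (ha : a ∈ unitDisk) (hz : z ∈ unitDisk) :
    diskAut a z ∈ unitDisk := by
  have hpos : 0 < 1 - ‖diskAut a z‖ ^ 2 := by
    rw [one_sub_normSq_diskAut ha hz]
    have := one_sub_normSq_pos ha
    have := one_sub_normSq_pos hz
    have := norm_pos_iff.2 (one_sub_conj_mul_ne_zero ha hz)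
    positivity
  rw [mem_unitDisk_iff]
  nlinarith [norm_nonneg (diskAut a z)]

theorem diskAut_neg_diskAut (ha : a ∈ unitDisk) (hz : z ∈ unitDisk) :
    diskAut (-a) (diskAut a z) = z := by
  have hne := one_sub_conj_mul_ne_zero ha hz
  have haa := one_sub_conj_mul_ne_zero ha ha
  have hnum : diskAut a z - -a = (1 - conj a * a) * z / (1 - conj a * z) := by
    rw [diskAut, sub_neg_eq_add, eq_div_iff hne, add_mul, div_mul_cancel₀ _ hne]
    ring
  have hden : 1 - conj (-a) * diskAut a z = (1 - conj a * a) / (1 - conj a * z) := by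
    rw [diskAut, map_neg, eq_div_iff hne, sub_mul, mul_assoc, div_mul_cancel₀ _ hne]
    ring
  rw [diskAut, hnum, hden, div_div_div_cancel_right₀ hne, mul_div_cancel_left₀ _ haa]

theorem hasDerivAt_diskAut (ha : a ∈ unitDisk) (hz : z ∈ unitDisk) :
    HasDerivAt (diskAut a) (((1 - ‖a‖ ^ 2 : ℝ) : ℂ) / (1 - conj a * z) ^ 2) z := by
  have hden : HasDerivAt (fun z => 1 - conj a * z) (-conj a) z := by
    simpa using ((hasDerivAt_id z).const_mul (conj a)).const_sub 1
  refine (((hasDerivAt_id z).sub_const a).div hden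
    (one_sub_conj_mul_ne_zero ha hz)).congr_deriv ?_
  rw [← one_sub_conj_mul_self]
  simp only [id]
  ring

theorem differentiableOn_diskAut (ha : a ∈ unitDisk) :
    DifferentiableOn ℂ (diskAut a) unitDisk := fun _ hz =>
  (hasDerivAt_diskAut ha hz).differentiableAt.differentiableWithinAt

end DiskAut

section SchwarzPick

variable {g : ℂ → ℂ} {z : ℂ}

theorem norm_deriv_mul_le_of_mapsTo_unitDisk (hg : DifferentiableOn ℂ g unitDisk)
    (hmaps : MapsTo g unitDisk unitDisk) (hz : z ∈ unitDisk) :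
    ‖deriv g z‖ * (1 - ‖z‖ ^ 2) ≤ 1 - ‖g z‖ ^ 2 := by
  have hnz := neg_mem_unitDisk hz
  have h0 : (0 : ℂ) ∈ unitDisk := by simp [unitDisk]
  have hM0 : diskAut (-z) 0 = z := by simp [diskAut_zero]
  set h : ℂ → ℂ := diskAut (g z) ∘ g ∘ diskAut (-z)
  have inner_maps : MapsTo (diskAut (-z)) unitDisk unitDisk := fun _ => diskAut_mem_unitDisk hnz
  have h_diff : DifferentiableOn ℂ h unitDisk := (differentiableOn_diskAut (hmaps hz)).comp
    (hg.comp (differentiableOn_diskAut hnz) inner_maps) (hmaps.comp inner_maps)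
  have h_zero : h 0 = 0 := by simp [h, hM0, diskAut_self]
  have schwarz : ‖deriv h 0‖ ≤ 1 := by
    refine Complex.norm_deriv_le_one_of_mapsTo_ball h_diff (fun w hw => ?_) one_pos
    rw [h_zero]
    exact Metric.ball_subset_closedBall
      (diskAut_mem_unitDisk (hmaps hz) (hmaps (inner_maps hw)))
  have hgz : HasDerivAt g (deriv g z) (diskAut (-z) 0) := by
    rw [hM0]
    exact (hg.differentiableAt (isOpen_unitDisk.mem_nhds hz)).hasDerivAt
  have outer : HasDerivAt (diskAut (g z)) (((1 - ‖g z‖ ^ 2 : ℝ) : ℂ) / (1 - conj (g z) * g z) ^ 2)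
      ((g ∘ diskAut (-z)) 0) := by
    simpa [hM0] using hasDerivAt_diskAut (hmaps hz) (hmaps hz)
  have hgpos := one_sub_normSq_pos (hmaps hz)
  have hzpos := one_sub_normSq_pos hz
  rw [(outer.comp 0 (hgz.comp 0 (hasDerivAt_diskAut hnz h0))).deriv, one_sub_conj_mul_self,
    norm_mul, norm_mul, norm_div, norm_div, norm_pow, norm_neg, Complex.norm_of_nonneg hgpos.le,
    Complex.norm_of_nonneg hzpos.le] at schwarz
  simp only [mul_zero, sub_zero, norm_one, one_pow, div_one] at schwarz
  rwa [sq (1 - ‖g z‖ ^ 2), div_self_mul_self', inv_mul_le_iff₀ hgpos, mul_one] at schwarz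

theorem norm_deriv_mul_le_of_norm_le_one (hg : DifferentiableOn ℂ g unitDisk)
    (hle : ∀ z ∈ unitDisk, ‖g z‖ ≤ 1) (hz : z ∈ unitDisk) :
    ‖deriv g z‖ * (1 - ‖z‖ ^ 2) ≤ 1 - ‖g z‖ ^ 2 := by
  have shrunk : ∀ t ∈ Ioo (0 : ℝ) 1, t * ‖deriv g z‖ * (1 - ‖z‖ ^ 2) ≤ 1 - (t * ‖g z‖) ^ 2 := by
    intro t ht
    have ht_mem : (t : ℂ) ∈ unitDisk := by
      rw [mem_unitDisk_iff, Complex.norm_of_nonneg ht.1.le]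
      exact ht.2
    have := norm_deriv_mul_le_of_mapsTo_unitDisk (hg.const_mul (t : ℂ)) (fun w hw => by
      exact mem_unitDisk_iff.2 (norm_mul_lt_one_of_mem_unitDisk ht_mem (hle w hw))) hz
    rwa [deriv_const_mul _ (hg.differentiableAt (isOpen_unitDisk.mem_nhds hz)), norm_mul, norm_mul,
      Complex.norm_of_nonneg ht.1.le] at this
  have gap_lim : Tendsto (fun t : ℝ => 1 - (t * ‖g z‖) ^ 2 - t * ‖deriv g z‖ * (1 - ‖z‖ ^ 2))
      (𝓝[<] 1) (𝓝 (1 - (1 * ‖g z‖) ^ 2 - 1 * ‖deriv g z‖ * (1 - ‖z‖ ^ 2))) :=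
    (Continuous.tendsto (by fun_prop) 1).mono_left nhdsWithin_le_nhds
  have gap_nonneg := ge_of_tendsto gap_lim <| by
    filter_upwards [Ioo_mem_nhdsLT (zero_lt_one' ℝ)] with t ht using sub_nonneg.2 (shrunk t ht)
  simpa using gap_nonneg

theorem exists_mapsTo_unitDisk_deriv_mul_eq {a b : ℂ} (ha : a ∈ unitDisk) (hb : b ∈ unitDisk) :
    ∃ φ : ℂ → ℂ, DifferentiableOn ℂ φ unitDisk ∧ MapsTo φ unitDisk unitDisk ∧ φ a = b ∧
      deriv φ a * (1 - conj a * a) = -(1 - conj b * b) := by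
  have haut : MapsTo (diskAut a) unitDisk unitDisk := fun _ => diskAut_mem_unitDisk ha
  have houter : HasDerivAt (diskAut b) (1 - conj b * b) (diskAut a a) := by
    simpa [diskAut_self, one_sub_conj_mul_self] using
      hasDerivAt_diskAut hb (by simp [unitDisk] : (0 : ℂ) ∈ unitDisk)
  have hderiv := (houter.comp a (hasDerivAt_diskAut ha ha)).neg
  refine ⟨-(diskAut b ∘ diskAut a),
    ((differentiableOn_diskAut hb).comp (differentiableOn_diskAut ha) haut).neg,
    fun w hw => neg_mem_unitDisk (diskAut_mem_unitDisk hb (haut hw)),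
    by simp [diskAut_self, diskAut_zero], ?_⟩
  have hne := one_sub_conj_mul_ne_zero ha ha
  rw [hderiv.deriv, ← one_sub_conj_mul_self]
  field_simp

end SchwarzPick

section HypDist

variable {z₁ z₂ : ℂ}

theorem hypDist_eq_artanh (hz₁ : z₁ ∈ unitDisk) (hz₂ : z₂ ∈ unitDisk) :
    hypDist z₁ z₂ = Real.artanh ‖diskAut z₁ z₂‖ := by
  have hlt := mem_unitDisk_iff.1 (diskAut_mem_unitDisk hz₁ hz₂)
  rw [Real.artanh_eq_half_log ⟨by linarith [norm_nonneg (diskAut z₁ z₂)], hlt.le⟩, hypDist,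
    pseudoHypDist, diskAut, norm_div, norm_div, norm_sub_rev]

theorem hypDist_nonneg (hz₁ : z₁ ∈ unitDisk) (hz₂ : z₂ ∈ unitDisk) : 0 ≤ hypDist z₁ z₂ := by
  rw [hypDist_eq_artanh hz₁ hz₂]
  exact Real.artanh_nonneg (norm_nonneg _)

theorem hasDerivAt_tanh (t : ℝ) : HasDerivAt Real.tanh (Real.cosh t ^ 2)⁻¹ t := by
  have hquot := (Real.hasDerivAt_sinh t).div (Real.hasDerivAt_cosh t) (Real.cosh_pos t).ne'
  rw [show Real.tanh = Real.sinh / Real.cosh from funext Real.tanh_eq_sinh_div_cosh]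
  refine hquot.congr_deriv ?_
  rw [← sq, ← sq, Real.cosh_sq_sub_sinh_sq, one_div]

theorem one_sub_tanh_sq (t : ℝ) : 1 - Real.tanh t ^ 2 = (Real.cosh t ^ 2)⁻¹ := by
  have := (Real.cosh_pos t).ne'
  rw [Real.tanh_eq_sinh_div_cosh, div_pow, ← one_div, eq_div_iff (by positivity), sub_mul,
    div_mul_cancel₀ _ (by positivity), one_mul, Real.cosh_sq_sub_sinh_sq]

end HypDist

/-- The unit-speed hyperbolic geodesic that leaves `z₁` in the direction of the unit vector `ζ`. -/
noncomputable def hypGeodesic (z₁ ζ : ℂ) (t : ℝ) : ℂ := diskAut (-z₁) (ζ * Real.tanh t)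

/-- The denominator of the geodesic in the form `(z₁ cosh t + ζ sinh t) / hypGeodesicDen z₁ ζ t`;
up to a constant factor it is the inverse square root of the complex velocity. -/
noncomputable def hypGeodesicDen (z₁ ζ : ℂ) (t : ℝ) : ℂ := Real.cosh t + conj z₁ * ζ * Real.sinh t

section Geodesic

variable {z₁ z₂ ζ : ℂ}

theorem mul_tanh_mem_unitDisk (hζ : ‖ζ‖ = 1) (t : ℝ) : ζ * Real.tanh t ∈ unitDisk := by
  rw [mem_unitDisk_iff, norm_mul, hζ, one_mul, Complex.norm_real]
  exact Real.abs_tanh_lt_one t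

theorem hypGeodesic_mem_unitDisk (hz₁ : z₁ ∈ unitDisk) (hζ : ‖ζ‖ = 1) (t : ℝ) :
    hypGeodesic z₁ ζ t ∈ unitDisk :=
  diskAut_mem_unitDisk (neg_mem_unitDisk hz₁) (mul_tanh_mem_unitDisk hζ t)

theorem hypGeodesic_zero (z₁ ζ : ℂ) : hypGeodesic z₁ ζ 0 = z₁ := by
  simp [hypGeodesic, diskAut_zero]

theorem hypGeodesicDen_zero (z₁ ζ : ℂ) : hypGeodesicDen z₁ ζ 0 = 1 := by simp [hypGeodesicDen]

theorem hypDist_hypGeodesic (hz₁ : z₁ ∈ unitDisk) (hζ : ‖ζ‖ = 1) {t : ℝ} (ht : 0 ≤ t) :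
    hypDist z₁ (hypGeodesic z₁ ζ t) = t := by
  have tanh_nonneg : 0 ≤ Real.tanh t := by
    rw [Real.tanh_eq_sinh_div_cosh]
    exact div_nonneg (Real.sinh_nonneg_iff.2 ht) (Real.cosh_pos t).le
  have hback : diskAut z₁ (hypGeodesic z₁ ζ t) = ζ * Real.tanh t := by
    simpa [hypGeodesic] using
      diskAut_neg_diskAut (neg_mem_unitDisk hz₁) (mul_tanh_mem_unitDisk hζ t)
  rw [hypDist_eq_artanh hz₁ (hypGeodesic_mem_unitDisk hz₁ hζ t), hback, norm_mul, hζ, one_mul,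
    Complex.norm_of_nonneg tanh_nonneg, Real.artanh_tanh]

theorem exists_hypGeodesic_hypDist_eq (hz₁ : z₁ ∈ unitDisk) (hz₂ : z₂ ∈ unitDisk) :
    ∃ ζ : ℂ, ‖ζ‖ = 1 ∧ hypGeodesic z₁ ζ (hypDist z₁ z₂) = z₂ := by
  obtain ⟨ζ, hζ, hpolar⟩ : ∃ ζ : ℂ, ‖ζ‖ = 1 ∧ ζ * ‖diskAut z₁ z₂‖ = diskAut z₁ z₂ :=
    ⟨Complex.exp (Complex.arg (diskAut z₁ z₂) * Complex.I), Complex.norm_exp_ofReal_mul_I _, by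
      rw [mul_comm, Complex.norm_mul_exp_arg_mul_I]⟩
  refine ⟨ζ, hζ, ?_⟩
  have hlt := mem_unitDisk_iff.1 (diskAut_mem_unitDisk hz₁ hz₂)
  rw [hypGeodesic, hypDist_eq_artanh hz₁ hz₂,
    Real.tanh_artanh ⟨by linarith [norm_nonneg (diskAut z₁ z₂)], hlt⟩, hpolar,
    diskAut_neg_diskAut hz₁ hz₂]

theorem hypGeodesicDen_eq_cosh_mul (z₁ ζ : ℂ) (t : ℝ) :
    hypGeodesicDen z₁ ζ t = Real.cosh t * (1 - conj (-z₁) * (ζ * Real.tanh t)) := by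
  have : (Real.cosh t : ℂ) ≠ 0 := by exact_mod_cast (Real.cosh_pos t).ne'
  rw [hypGeodesicDen, Real.tanh_eq_sinh_div_cosh, map_neg]
  push_cast at this ⊢
  field_simp
  ring

theorem hypGeodesicDen_ne_zero (hz₁ : z₁ ∈ unitDisk) (hζ : ‖ζ‖ = 1) (t : ℝ) :
    hypGeodesicDen z₁ ζ t ≠ 0 := by
  rw [hypGeodesicDen_eq_cosh_mul]
  exact mul_ne_zero (by exact_mod_cast (Real.cosh_pos t).ne')
    (one_sub_conj_mul_ne_zero (neg_mem_unitDisk hz₁) (mul_tanh_mem_unitDisk hζ t))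

theorem one_sub_normSq_hypGeodesic (hz₁ : z₁ ∈ unitDisk) (hζ : ‖ζ‖ = 1) (t : ℝ) :
    1 - ‖hypGeodesic z₁ ζ t‖ ^ 2 = (1 - ‖z₁‖ ^ 2) / ‖hypGeodesicDen z₁ ζ t‖ ^ 2 := by
  rw [hypGeodesicDen_eq_cosh_mul, hypGeodesic,
    one_sub_normSq_diskAut (neg_mem_unitDisk hz₁) (mul_tanh_mem_unitDisk hζ t), norm_neg,
    norm_mul ζ, hζ, one_mul, norm_mul, Complex.norm_real, Complex.norm_of_nonneg
    (Real.cosh_pos t).le, Real.norm_eq_abs, sq_abs, one_sub_tanh_sq, mul_pow, ← div_eq_mul_inv,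
    div_div]

theorem hasDerivAt_hypGeodesic (hz₁ : z₁ ∈ unitDisk) (hζ : ‖ζ‖ = 1) (t : ℝ) :
    HasDerivAt (hypGeodesic z₁ ζ)
      (ζ * ((1 - ‖z₁‖ ^ 2 : ℝ) : ℂ) / hypGeodesicDen z₁ ζ t ^ 2) t := by
  refine ((hasDerivAt_diskAut (neg_mem_unitDisk hz₁) (mul_tanh_mem_unitDisk hζ t)).comp t
    ((hasDerivAt_tanh t).ofReal_comp.const_mul ζ)).congr_deriv ?_
  rw [hypGeodesicDen_eq_cosh_mul, norm_neg, Complex.ofReal_inv, Complex.ofReal_pow,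
    ← div_eq_mul_inv, div_mul_div_comm]
  congr 1 <;> ring

theorem hasDerivAt_hypGeodesicDen (z₁ ζ : ℂ) (t : ℝ) : HasDerivAt (hypGeodesicDen z₁ ζ)
    (Real.sinh t + conj z₁ * ζ * Real.cosh t) t :=
  (Real.hasDerivAt_cosh t).ofReal_comp.add ((Real.hasDerivAt_sinh t).ofReal_comp.const_mul _)

theorem hasDerivAt_deriv_hypGeodesicDen (z₁ ζ : ℂ) (t : ℝ) :
    HasDerivAt (fun t : ℝ => (Real.sinh t + conj z₁ * ζ * Real.cosh t : ℂ))
      (hypGeodesicDen z₁ ζ t) t :=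
  (Real.hasDerivAt_sinh t).ofReal_comp.add ((Real.hasDerivAt_cosh t).ofReal_comp.const_mul _)

end Geodesic

/-- The Schwarzian derivative `(f''/f')' - (f''/f')²/2`. -/
noncomputable def schwarzian (f : ℂ → ℂ) (z : ℂ) : ℂ :=
  deriv (logDeriv (deriv f)) z - logDeriv (deriv f) z ^ 2 / 2

/-- The coefficient `q` of the linear equation `v'' = q v` solved by the two-point distortion of `f`
along the geodesic from `z₁` in the direction `ζ`, in which the Schwarzian derivative enters as a
quadratic differential evaluated on the velocity. -/
noncomputable def geodesicCoeff (f : ℂ → ℂ) (z₁ ζ : ℂ) (t : ℝ) : ℂ :=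
  1 - schwarzian f (hypGeodesic z₁ ζ t) / 2 * deriv (hypGeodesic z₁ ζ) t ^ 2

section Schwarzian

variable {f g : ℂ → ℂ} {z₁ ζ : ℂ}

theorem exists_hasDerivAt_logDeriv_exp_eq (hg : DifferentiableOn ℂ g unitDisk)
    (hg0 : ∀ z ∈ unitDisk, g z ≠ 0) :
    ∃ P : ℂ → ℂ, ∀ z ∈ unitDisk, HasDerivAt P (logDeriv g z) z ∧ Complex.exp (P z) = g z := by
  have h0 : (0 : ℂ) ∈ unitDisk := by simp [unitDisk]
  have logDeriv_diff : DifferentiableOn ℂ (logDeriv g) unitDisk :=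
    (hg.deriv isOpen_unitDisk).div hg hg0
  obtain ⟨P, hP0, hP⟩ := logDeriv_diff.isExactOn_ball.with_val_at 0 (Complex.log (g 0))
  have hexp : ∀ z ∈ unitDisk, HasDerivAt (fun z => Complex.exp (P z))
      (Complex.exp (P z) * logDeriv g z) z := fun z hz => (hP z hz).cexp
  have same_logDeriv : EqOn (logDeriv fun z => Complex.exp (P z)) (logDeriv g) unitDisk :=
    fun z hz => by
      rw [logDeriv_apply, (hexp z hz).deriv, mul_div_cancel_left₀ _ (Complex.exp_ne_zero _)]
  obtain ⟨c, -, hc⟩ := (logDeriv_eqOn_iff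
    (fun z hz => (hexp z hz).differentiableAt.differentiableWithinAt) hg isOpen_unitDisk
    (Metric.isConnected_ball one_pos).isPreconnected hg0
    (fun z _ => Complex.exp_ne_zero _)).1 same_logDeriv
  have c_eq_one : c = 1 := by
    have at_zero := hc h0
    simp only [hP0, Complex.exp_log (hg0 0 h0), Pi.smul_apply, smul_eq_mul] at at_zero
    exact (mul_eq_right₀ (hg0 0 h0)).1 at_zero.symm
  exact ⟨P, fun z hz => ⟨hP z hz, by simpa [c_eq_one] using hc hz⟩⟩

theorem differentiableOn_logDeriv_deriv (hf : DifferentiableOn ℂ f unitDisk)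
    (hf' : ∀ z ∈ unitDisk, deriv f z ≠ 0) : DifferentiableOn ℂ (logDeriv (deriv f)) unitDisk :=
  have hderiv := hf.deriv isOpen_unitDisk
  (hderiv.deriv isOpen_unitDisk).div hderiv hf'

theorem differentiableOn_schwarzian (hf : DifferentiableOn ℂ f unitDisk)
    (hf' : ∀ z ∈ unitDisk, deriv f z ≠ 0) : DifferentiableOn ℂ (schwarzian f) unitDisk :=
  have hT := differentiableOn_logDeriv_deriv hf hf'
  (hT.deriv isOpen_unitDisk).sub ((hT.pow 2).div_const 2)

-- The solution is `(f - f z₁) / √f'`, divided by its derivative at `z₁`.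
theorem exists_solution_schwarzian (hf : DifferentiableOn ℂ f unitDisk)
    (hf' : ∀ z ∈ unitDisk, deriv f z ≠ 0) (hz₁ : z₁ ∈ unitDisk) :
    ∃ V V' : ℂ → ℂ, (∀ z ∈ unitDisk, HasDerivAt V (V' z) z) ∧
      (∀ z ∈ unitDisk, HasDerivAt V' (-(schwarzian f z / 2) * V z) z) ∧ V z₁ = 0 ∧ V' z₁ = 1 ∧
      ∀ z ∈ unitDisk, ‖V z‖ = ‖f z₁ - f z‖ / √(‖deriv f z₁‖ * ‖deriv f z‖) := by
  have mem_nhds {z} (hz : z ∈ unitDisk) := isOpen_unitDisk.mem_nhds hz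
  obtain ⟨P, hP⟩ := exists_hasDerivAt_logDeriv_exp_eq (hf.deriv isOpen_unitDisk) hf'
  set T := logDeriv (deriv f) with hT
  set E : ℂ → ℂ := fun z => Complex.exp (-(P z + P z₁) / 2) with hE
  have derivE : ∀ z ∈ unitDisk, HasDerivAt E (-(T z / 2) * E z) z := fun z hz =>
    (((hP z hz).1.add_const (P z₁)).fun_neg.div_const 2).cexp.congr_deriv (by simp only [hE]; ring)
  have deriv_f : ∀ z ∈ unitDisk, HasDerivAt (fun z => f z - f z₁) (deriv f z) z := fun z hz =>
    (hf.hasDerivAt (mem_nhds hz)).sub_const _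
  have deriv_f' : ∀ z ∈ unitDisk, HasDerivAt (deriv f) (deriv f z * T z) z := fun z hz => by
    rw [hT, logDeriv_apply, mul_div_cancel₀ _ (hf' z hz)]
    exact (hf.deriv isOpen_unitDisk).hasDerivAt (mem_nhds hz)
  have deriv_T : ∀ z ∈ unitDisk, HasDerivAt T (deriv T z) z := fun z hz =>
    (differentiableOn_logDeriv_deriv hf hf').hasDerivAt (mem_nhds hz)
  refine ⟨fun z => (f z - f z₁) * E z, fun z => (deriv f z - (f z - f z₁) * (T z / 2)) * E z,
    fun z hz => ?_, fun z hz => ?_, by simp, ?_, fun z hz => ?_⟩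
  · exact ((deriv_f z hz).mul (derivE z hz)).congr_deriv (by ring)
  · refine (((deriv_f' z hz).sub ((deriv_f z hz).mul ((deriv_T z hz).div_const 2))).mul
      (derivE z hz)).congr_deriv ?_
    simp only [schwarzian, ← hT, Pi.sub_apply, Pi.mul_apply]
    ring
  · have : E z₁ = (deriv f z₁)⁻¹ := by
      rw [← (hP z₁ hz₁).2, ← Complex.exp_neg]
      simp only [hE]
      ring_nf
    simp [this, hf' z₁ hz₁]
  · have E_sq : E z ^ 2 = (deriv f z₁ * deriv f z)⁻¹ := by
      rw [← (hP z hz).2, ← (hP z₁ hz₁).2, ← Complex.exp_add, ← Complex.exp_neg,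
        ← Complex.exp_nat_mul]
      ring_nf
    rw [← norm_mul, norm_mul _ (E z), norm_sub_rev, div_eq_mul_inv, ← Real.sqrt_inv, ← norm_inv,
      ← E_sq, norm_pow, Real.sqrt_sq (norm_nonneg _)]

theorem norm_deriv_hypGeodesic (hz₁ : z₁ ∈ unitDisk) (hζ : ‖ζ‖ = 1) (t : ℝ) :
    ‖deriv (hypGeodesic z₁ ζ) t‖ = 1 - ‖hypGeodesic z₁ ζ t‖ ^ 2 := by
  rw [(hasDerivAt_hypGeodesic hz₁ hζ t).deriv, one_sub_normSq_hypGeodesic hz₁ hζ, norm_div,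
    norm_mul, hζ, one_mul, Complex.norm_of_nonneg (one_sub_normSq_pos hz₁).le, norm_pow]

theorem norm_one_sub_geodesicCoeff (hz₁ : z₁ ∈ unitDisk) (hζ : ‖ζ‖ = 1) (t : ℝ) :
    ‖1 - geodesicCoeff f z₁ ζ t‖ =
      (1 - ‖hypGeodesic z₁ ζ t‖ ^ 2) ^ 2 * ‖schwarzian f (hypGeodesic z₁ ζ t)‖ / 2 := by
  rw [geodesicCoeff, sub_sub_cancel, norm_mul, norm_div, norm_pow, norm_deriv_hypGeodesic hz₁ hζ,
    Complex.norm_two]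
  ring

theorem geodesicCoeff_zero (hz₁ : z₁ ∈ unitDisk) (hζ : ‖ζ‖ = 1) :
    geodesicCoeff f z₁ ζ 0 =
      1 - ζ ^ 2 * (((1 - ‖z₁‖ ^ 2) ^ 2 / 2 : ℝ) * schwarzian f z₁) := by
  rw [geodesicCoeff, (hasDerivAt_hypGeodesic hz₁ hζ 0).deriv, hypGeodesic_zero,
    hypGeodesicDen_zero]
  push_cast
  ring

theorem continuous_geodesicCoeff (hf : DifferentiableOn ℂ f unitDisk)
    (hf' : ∀ z ∈ unitDisk, deriv f z ≠ 0) (hz₁ : z₁ ∈ unitDisk) (hζ : ‖ζ‖ = 1) :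
    Continuous (geodesicCoeff f z₁ ζ) := by
  have velocity : deriv (hypGeodesic z₁ ζ) =
      fun t => ζ * ((1 - ‖z₁‖ ^ 2 : ℝ) : ℂ) / hypGeodesicDen z₁ ζ t ^ 2 :=
    funext fun t => (hasDerivAt_hypGeodesic hz₁ hζ t).deriv
  have hγ : Continuous (hypGeodesic z₁ ζ) :=
    continuous_iff_continuousAt.2 fun t => (hasDerivAt_hypGeodesic hz₁ hζ t).continuousAt
  have hDen : Continuous (hypGeodesicDen z₁ ζ) :=
    continuous_iff_continuousAt.2 fun t => (hasDerivAt_hypGeodesicDen z₁ ζ t).continuousAt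
  have hS : Continuous fun t => schwarzian f (hypGeodesic z₁ ζ t) :=
    (differentiableOn_schwarzian hf hf').continuousOn.comp_continuous hγ
      (hypGeodesic_mem_unitDisk hz₁ hζ)
  have hvel : Continuous (deriv (hypGeodesic z₁ ζ)) := by
    rw [velocity]
    exact continuous_const.div (hDen.pow 2) fun t =>
      pow_ne_zero 2 (hypGeodesicDen_ne_zero hz₁ hζ t)
  exact continuous_const.sub ((hS.div_const 2).mul (hvel.pow 2))

-- `D` is a multiple of the inverse square root of `γ'`, so this is Liouville's change of variable;
-- the Schwarzian derivative of `γ`, which is the constant `-2`, contributes the `1`.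
theorem exists_solution_along_hypGeodesic {V V' Q : ℂ → ℂ}
    (hV : ∀ z ∈ unitDisk, HasDerivAt V (V' z) z)
    (hV' : ∀ z ∈ unitDisk, HasDerivAt V' (Q z * V z) z) (hz₁ : z₁ ∈ unitDisk) (hζ : ‖ζ‖ = 1) :
    ∃ w' : ℝ → ℂ, (∀ t, HasDerivAt
        (fun t => hypGeodesicDen z₁ ζ t * V (hypGeodesic z₁ ζ t)) (w' t) t) ∧
      (∀ t, HasDerivAt w' ((1 + Q (hypGeodesic z₁ ζ t) * deriv (hypGeodesic z₁ ζ) t ^ 2) *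
        (hypGeodesicDen z₁ ζ t * V (hypGeodesic z₁ ζ t))) t) ∧
      w' 0 = conj z₁ * ζ * V z₁ + ζ * ((1 - ‖z₁‖ ^ 2 : ℝ) : ℂ) * V' z₁ := by
  have hγ := hypGeodesic_mem_unitDisk hz₁ hζ
  have hγ' := hasDerivAt_hypGeodesic hz₁ hζ
  have hD := hasDerivAt_hypGeodesicDen z₁ ζ
  have hD' := hasDerivAt_deriv_hypGeodesicDen z₁ ζ
  have hDne := hypGeodesicDen_ne_zero hz₁ hζ
  have hγ0 := hypGeodesic_zero z₁ ζ
  have hD0 := hypGeodesicDen_zero z₁ ζ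
  set K : ℂ := ζ * ((1 - ‖z₁‖ ^ 2 : ℝ) : ℂ)
  set γ := hypGeodesic z₁ ζ
  set D := hypGeodesicDen z₁ ζ
  have hVγ : ∀ t, HasDerivAt (V ∘ γ) (V' (γ t) * (K / D t ^ 2)) t := fun t =>
    (hV _ (hγ t)).comp t (hγ' t)
  have hV'γ : ∀ t, HasDerivAt (V' ∘ γ) (Q (γ t) * V (γ t) * (K / D t ^ 2)) t := fun t =>
    (hV' _ (hγ t)).comp t (hγ' t)
  refine ⟨fun t => (Real.sinh t + conj z₁ * ζ * Real.cosh t) * V (γ t) + K * V' (γ t) / D t,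
    fun t => ?_, fun t => ?_, by simp [hγ0, hD0]⟩
  · refine ((hD t).mul (hVγ t)).congr_deriv ?_
    have := hDne t
    simp only [Function.comp_apply]
    field_simp
  · refine (((hD' t).mul (hVγ t)).add (((hV'γ t).const_mul K).div (hD t) (hDne t))).congr_deriv ?_
    have := hDne t
    rw [(hγ' t).deriv]
    simp only [Function.comp_apply]
    field_simp
    ring

theorem twoPointDistortion_hypGeodesic (f : ℂ → ℂ) (hz₁ : z₁ ∈ unitDisk) (hζ : ‖ζ‖ = 1) (t : ℝ) :
    twoPointDistortion f z₁ (hypGeodesic z₁ ζ t) =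
      ‖hypGeodesicDen z₁ ζ t‖ / (1 - ‖z₁‖ ^ 2) * (‖f z₁ - f (hypGeodesic z₁ ζ t)‖ /
        √(‖deriv f z₁‖ * ‖deriv f (hypGeodesic z₁ ζ t)‖)) := by
  have hr := one_sub_normSq_pos hz₁
  have hDpos := norm_pos_iff.2 (hypGeodesicDen_ne_zero hz₁ hζ t)
  have den_eq : √((1 - ‖z₁‖ ^ 2) * ‖deriv f z₁‖ * ((1 - ‖hypGeodesic z₁ ζ t‖ ^ 2) *
      ‖deriv f (hypGeodesic z₁ ζ t)‖)) = (1 - ‖z₁‖ ^ 2) / ‖hypGeodesicDen z₁ ζ t‖ *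
        √(‖deriv f z₁‖ * ‖deriv f (hypGeodesic z₁ ζ t)‖) := by
    rw [← Real.sqrt_sq (div_pos hr hDpos).le, ← Real.sqrt_mul (sq_nonneg _),
      one_sub_normSq_hypGeodesic hz₁ hζ]
    ring_nf
  rw [twoPointDistortion, den_eq, div_mul_eq_div_div, div_div_eq_mul_div]
  ring

theorem exists_solution_geodesicCoeff (hf : DifferentiableOn ℂ f unitDisk)
    (hf' : ∀ z ∈ unitDisk, deriv f z ≠ 0) (hz₁ : z₁ ∈ unitDisk) (hζ : ‖ζ‖ = 1) :
    ∃ v v' : ℝ → ℂ, (∀ t, HasDerivAt v (v' t) t) ∧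
      (∀ t, HasDerivAt v' (geodesicCoeff f z₁ ζ t * v t) t) ∧ v 0 = 0 ∧ v' 0 = 1 ∧
      ∀ t, ‖v t‖ = twoPointDistortion f z₁ (hypGeodesic z₁ ζ t) := by
  obtain ⟨V, V', hV, hV', hV0, hV'0, hVnorm⟩ := exists_solution_schwarzian hf hf' hz₁
  obtain ⟨w', hw, hw', hw'0⟩ := exists_solution_along_hypGeodesic hV hV' hz₁ hζ
  have hr := one_sub_normSq_pos hz₁
  have hKnorm : ‖ζ * ((1 - ‖z₁‖ ^ 2 : ℝ) : ℂ)‖ = 1 - ‖z₁‖ ^ 2 := by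
    rw [norm_mul, hζ, one_mul, Complex.norm_of_nonneg hr.le]
  set K : ℂ := ζ * ((1 - ‖z₁‖ ^ 2 : ℝ) : ℂ)
  have hK : K ≠ 0 := norm_pos_iff.1 (hKnorm ▸ hr)
  refine ⟨fun t => hypGeodesicDen z₁ ζ t * V (hypGeodesic z₁ ζ t) / K, fun t => w' t / K,
    fun t => (hw t).div_const K, fun t => ((hw' t).div_const K).congr_deriv ?_,
    by simp [hypGeodesic_zero, hV0], by simp [hw'0, hV0, hV'0, hK], fun t => ?_⟩
  · rw [geodesicCoeff, sub_eq_add_neg, neg_mul_eq_neg_mul, mul_div_assoc]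
  · rw [twoPointDistortion_hypGeodesic f hz₁ hζ, norm_div, norm_mul, hKnorm,
      hVnorm _ (hypGeodesic_mem_unitDisk hz₁ hζ t), div_mul_eq_mul_div]

theorem twoPointDistortion_le_sinh {κ : ℝ} (hf : DifferentiableOn ℂ f unitDisk)
    (hf' : ∀ z ∈ unitDisk, deriv f z ≠ 0) (hκ : 0 < κ)
    (hS : ∀ z ∈ unitDisk, (1 - ‖z‖ ^ 2) ^ 2 * ‖schwarzian f z‖ ≤ 2 * (κ ^ 2 - 1))
    (hz₁ : z₁ ∈ unitDisk) {z₂ : ℂ} (hz₂ : z₂ ∈ unitDisk) :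
    twoPointDistortion f z₁ z₂ ≤ κ⁻¹ * Real.sinh (κ * hypDist z₁ z₂) := by
  obtain ⟨ζ, hζ, hz₂_eq⟩ := exists_hypGeodesic_hypDist_eq hz₁ hz₂
  obtain ⟨v, v', hv, hv', hv0, hv'0, hnorm⟩ := exists_solution_geodesicCoeff hf hf' hz₁ hζ
  have coeff_le : ∀ t, ‖geodesicCoeff f z₁ ζ t‖ ≤ κ ^ 2 := fun t => by
    have htri := norm_sub_norm_le (geodesicCoeff f z₁ ζ t) 1
    rw [norm_sub_rev, norm_one_sub_geodesicCoeff hz₁ hζ, norm_one] at htri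
    linarith [hS _ (hypGeodesic_mem_unitDisk hz₁ hζ t)]
  have key := norm_le_mul_sinh_of_norm_deriv_deriv_le hv hv' hv0 hκ
    (fun t => (norm_mul_le _ _).trans (by gcongr; exact coeff_le t)) (hypDist_nonneg hz₁ hz₂)
  rwa [hnorm, hz₂_eq, hv'0, norm_one, one_mul, div_eq_inv_mul] at key

theorem sin_le_twoPointDistortion {δ : ℝ} (hf : DifferentiableOn ℂ f unitDisk)
    (hf' : ∀ z ∈ unitDisk, deriv f z ≠ 0) (hδ : 0 < δ)
    (hS : ∀ z ∈ unitDisk, (1 - ‖z‖ ^ 2) ^ 2 * ‖schwarzian f z‖ ≤ 2 * (1 + δ ^ 2))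
    (hz₁ : z₁ ∈ unitDisk) {z₂ : ℂ} (hz₂ : z₂ ∈ unitDisk) (hπ : δ * hypDist z₁ z₂ ≤ Real.pi) :
    δ⁻¹ * Real.sin (δ * hypDist z₁ z₂) ≤ twoPointDistortion f z₁ z₂ := by
  obtain ⟨ζ, hζ, hz₂_eq⟩ := exists_hypGeodesic_hypDist_eq hz₁ hz₂
  obtain ⟨v, v', hv, hv', hv0, hv'0, hnorm⟩ := exists_solution_geodesicCoeff hf hf' hz₁ hζ
  have le_coeff_re : ∀ t, -δ ^ 2 ≤ (geodesicCoeff f z₁ ζ t).re := fun t => by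
    have hre := Complex.re_le_norm (1 - geodesicCoeff f z₁ ζ t)
    rw [norm_one_sub_geodesicCoeff hz₁ hζ, Complex.sub_re, Complex.one_re] at hre
    linarith [hS _ (hypGeodesic_mem_unitDisk hz₁ hζ t)]
  have inner_eq : ∀ t, ⟪v t, geodesicCoeff f z₁ ζ t * v t⟫ =
      (geodesicCoeff f z₁ ζ t).re * ‖v t‖ ^ 2 := fun t => by
    rw [Complex.inner, mul_assoc, Complex.mul_conj', ← Complex.ofReal_pow, Complex.re_mul_ofReal]
  have key := norm_deriv_mul_sin_le_norm hv hv' hv0 hδ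
    (fun t => by rw [inner_eq]; gcongr; exact le_coeff_re t) (hypDist_nonneg hz₁ hz₂) hπ
  rwa [hnorm, hz₂_eq, hv'0, norm_one, one_mul, div_eq_inv_mul] at key

theorem exists_norm_eq_one_sq_mul_eq_norm (w : ℂ) : ∃ ζ : ℂ, ‖ζ‖ = 1 ∧ ζ ^ 2 * w = ‖w‖ := by
  refine ⟨Complex.exp (((-(w.arg / 2) : ℝ) : ℂ) * Complex.I),
    Complex.norm_exp_ofReal_mul_I _, ?_⟩
  nth_rw 2 [← Complex.norm_mul_exp_arg_mul_I w]
  rw [← Complex.exp_nat_mul, mul_left_comm, ← Complex.exp_add]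
  push_cast
  ring_nf
  simp

theorem hasDerivAt_mul_of_continuousAt_of_eq_zero {c v : ℝ → ℂ} {v' : ℂ} {x : ℝ}
    (hc : ContinuousAt c x) (hv : HasDerivAt v v' x) (hv0 : v x = 0) :
    HasDerivAt (fun t => c t * v t) (c x * v') x := by
  rw [hasDerivAt_iff_tendsto_slope] at hv ⊢
  refine ((hc.mono_left nhdsWithin_le_nhds).mul hv).congr fun t => ?_
  simp only [slope_def_module, hv0, mul_zero, sub_zero, mul_smul_comm]

theorem exists_cubic_solution_geodesicCoeff (hf : DifferentiableOn ℂ f unitDisk)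
    (hf' : ∀ z ∈ unitDisk, deriv f z ≠ 0) (hz₁ : z₁ ∈ unitDisk) (hζ : ‖ζ‖ = 1) {k : ℝ}
    (hk : geodesicCoeff f z₁ ζ 0 = k) :
    ∃ v v' v'' : ℝ → ℂ, (∀ t, HasDerivAt v (v' t) t) ∧ (∀ t, HasDerivAt v' (v'' t) t) ∧
      v 0 = 0 ∧ v'' 0 = 0 ∧ ‖v' 0‖ = 1 ∧ HasDerivAt v'' (k • v' 0) 0 ∧
      ∀ t, ‖v t‖ = twoPointDistortion f z₁ (hypGeodesic z₁ ζ t) := by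
  obtain ⟨v, v', hv, hv', hv0, hv'0, hnorm⟩ := exists_solution_geodesicCoeff hf hf' hz₁ hζ
  refine ⟨v, v', _, hv, hv', hv0, by simp [hv0], by simp [hv'0], ?_, hnorm⟩
  rw [Complex.real_smul, ← hk]
  exact hasDerivAt_mul_of_continuousAt_of_eq_zero
    (continuous_geodesicCoeff hf hf' hz₁ hζ).continuousAt (hv 0) hv0

theorem exists_hypDist_lt_of_eventually_hypGeodesic (hz₁ : z₁ ∈ unitDisk) (hζ : ‖ζ‖ = 1)
    {p : ℂ → ℝ → Prop} (hp : ∀ᶠ t in 𝓝[>] 0, p (hypGeodesic z₁ ζ t) t) {ε : ℝ} (hε : 0 < ε) :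
    ∃ z₂ ∈ unitDisk, hypDist z₁ z₂ < ε ∧ p z₂ (hypDist z₁ z₂) := by
  obtain ⟨t, hpt, ht0, htε⟩ := (hp.and (Ioo_mem_nhdsGT hε)).exists
  have hdist := hypDist_hypGeodesic hz₁ hζ ht0.le
  exact ⟨_, hypGeodesic_mem_unitDisk hz₁ hζ t, hdist.trans_lt htε, by rwa [hdist]⟩

theorem exists_twoPointDistortion_lt_sin {δ : ℝ} (hf : DifferentiableOn ℂ f unitDisk)
    (hf' : ∀ z ∈ unitDisk, deriv f z ≠ 0) (hδ : 0 < δ) (hz₁ : z₁ ∈ unitDisk)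
    (hS : 2 * (1 + δ ^ 2) < (1 - ‖z₁‖ ^ 2) ^ 2 * ‖schwarzian f z₁‖) {ε : ℝ} (hε : 0 < ε) :
    ∃ z₂ ∈ unitDisk, hypDist z₁ z₂ < ε ∧
      twoPointDistortion f z₁ z₂ < 1 / δ * Real.sin (δ * hypDist z₁ z₂) := by
  obtain ⟨ζ, hζ, hdir⟩ :=
    exists_norm_eq_one_sq_mul_eq_norm (((1 - ‖z₁‖ ^ 2) ^ 2 / 2 : ℝ) * schwarzian f z₁)
  rw [norm_mul, Complex.norm_of_nonneg (by positivity)] at hdir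
  have hk : geodesicCoeff f z₁ ζ 0 =
      ((1 - (1 - ‖z₁‖ ^ 2) ^ 2 / 2 * ‖schwarzian f z₁‖ : ℝ) : ℂ) := by
    rw [geodesicCoeff_zero hz₁ hζ, hdir, Complex.ofReal_sub, Complex.ofReal_one]
  obtain ⟨v, v', v'', hv, hv', hv0, hv''0, hv'0, hk', hnorm⟩ :=
    exists_cubic_solution_geodesicCoeff hf hf' hz₁ hζ hk
  have lt_sin := eventually_norm_lt_norm_of_cubic_lt hv hv' hv0 hv''0 hk'
    (hasDerivAt_sin_mul_div hδ.ne') (hasDerivAt_cos_mul hδ.ne') (by simp) (by simp)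
    ((hasDerivAt_sin_mul_div hδ.ne' 0).const_mul (-δ ^ 2)) hv'0 (by simp) (by linarith)
  refine exists_hypDist_lt_of_eventually_hypGeodesic hz₁ hζ
    (p := fun z t => twoPointDistortion f z₁ z < 1 / δ * Real.sin (δ * t)) ?_ hε
  filter_upwards [lt_sin, Ioo_mem_nhdsGT (div_pos Real.pi_pos hδ)] with t hlt ht
  have sin_nonneg : 0 ≤ Real.sin (δ * t) := Real.sin_nonneg_of_nonneg_of_le_pi
    (mul_pos hδ ht.1).le ((lt_div_iff₀' hδ).1 ht.2).le
  rwa [hnorm, Real.norm_of_nonneg (div_nonneg sin_nonneg hδ.le), ← one_div_mul_eq_div] at hlt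

theorem exists_sinh_lt_twoPointDistortion {κ : ℝ} (hf : DifferentiableOn ℂ f unitDisk)
    (hf' : ∀ z ∈ unitDisk, deriv f z ≠ 0) (hκ : 0 < κ) (hz₁ : z₁ ∈ unitDisk)
    (hS : 2 * (κ ^ 2 - 1) < (1 - ‖z₁‖ ^ 2) ^ 2 * ‖schwarzian f z₁‖) {ε : ℝ} (hε : 0 < ε) :
    ∃ z₂ ∈ unitDisk, hypDist z₁ z₂ < ε ∧
      1 / κ * Real.sinh (κ * hypDist z₁ z₂) < twoPointDistortion f z₁ z₂ := by
  obtain ⟨ζ, hζ, hdir⟩ :=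
    exists_norm_eq_one_sq_mul_eq_norm (-(((1 - ‖z₁‖ ^ 2) ^ 2 / 2 : ℝ) * schwarzian f z₁))
  rw [mul_neg, norm_neg, norm_mul, Complex.norm_of_nonneg (by positivity)] at hdir
  have hk : geodesicCoeff f z₁ ζ 0 =
      ((1 + (1 - ‖z₁‖ ^ 2) ^ 2 / 2 * ‖schwarzian f z₁‖ : ℝ) : ℂ) := by
    rw [geodesicCoeff_zero hz₁ hζ, sub_eq_add_neg, hdir, Complex.ofReal_add, Complex.ofReal_one]
  obtain ⟨v, v', v'', hv, hv', hv0, hv''0, hv'0, hk', hnorm⟩ :=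
    exists_cubic_solution_geodesicCoeff hf hf' hz₁ hζ hk
  have sinh_lt := eventually_norm_lt_norm_of_cubic_lt
    (hasDerivAt_sinh_mul_div hκ.ne') (hasDerivAt_cosh_mul hκ.ne') (by simp) (by simp)
    ((hasDerivAt_sinh_mul_div hκ.ne' 0).const_mul (κ ^ 2)) hv hv' hv0 hv''0 hk' (by simp) hv'0
    (by linarith)
  refine exists_hypDist_lt_of_eventually_hypGeodesic hz₁ hζ
    (p := fun z t => 1 / κ * Real.sinh (κ * t) < twoPointDistortion f z₁ z) ?_ hε
  filter_upwards [sinh_lt, self_mem_nhdsWithin] with t hlt (ht : 0 < t)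
  rwa [hnorm, Real.norm_of_nonneg (div_nonneg (Real.sinh_nonneg_iff.2 (by positivity)) hκ.le),
    ← one_div_mul_eq_div] at hlt

end Schwarzian

section ClassF

variable {α : ℝ} {f φ : ℂ → ℂ} {z : ℂ}

theorem norm_lt_norm_ofReal_add_iff {b : ℝ} (hb : 0 < b) {w : ℂ} :
    ‖w‖ < ‖(b : ℂ) + w‖ ↔ -(b / 2) < w.re := by
  have gap : ‖(b : ℂ) + w‖ ^ 2 - ‖w‖ ^ 2 = 2 * b * (w.re + b / 2) := by
    rw [← Complex.normSq_eq_norm_sq, ← Complex.normSq_eq_norm_sq, Complex.normSq_add,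
      Complex.normSq_ofReal, Complex.re_ofReal_mul, Complex.conj_re]
    ring
  rw [← sq_lt_sq₀ (norm_nonneg _) (norm_nonneg _), ← sub_pos, gap,
    mul_pos_iff_of_pos_left (by positivity), neg_lt_iff_pos_add]

theorem lt_re_one_add_iff (hα : α < 1) :
    α < (1 + z * deriv (deriv f) z / deriv f z).re ↔
      ‖z * logDeriv (deriv f) z‖ < ‖((2 * (1 - α) : ℝ) : ℂ) + z * logDeriv (deriv f) z‖ := by
  rw [norm_lt_norm_ofReal_add_iff (by linarith), logDeriv_apply, mul_div_assoc, Complex.add_re,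
    Complex.one_re, mul_div_cancel_left₀ _ (two_ne_zero' ℝ), neg_sub, sub_lt_iff_lt_add']

theorem norm_le_one_of_norm_mul_lt_one (hφ : DifferentiableOn ℂ φ unitDisk)
    (hlt : ∀ z ∈ unitDisk, ‖z * φ z‖ < 1) (hz : z ∈ unitDisk) : ‖φ z‖ ≤ 1 := by
  have hd : DifferentiableOn ℂ (fun w => w * φ w) unitDisk := differentiableOn_id.mul hφ
  have hmaps : MapsTo (fun w => w * φ w) (Metric.ball 0 1) (Metric.closedBall 0 1) :=
    fun w hw => mem_closedBall_zero_iff.2 (hlt w hw).le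
  rcases eq_or_ne z 0 with rfl | hz0
  · have schwarz := Complex.norm_deriv_le_one_of_mapsTo_ball hd (by simpa using hmaps) one_pos
    rw [((hasDerivAt_id' (0 : ℂ)).fun_mul
      (hφ.hasDerivAt (isOpen_unitDisk.mem_nhds hz))).deriv] at schwarz
    simpa using schwarz
  · have schwarz := Complex.norm_le_norm_of_mapsTo_ball hd hmaps (by simp) (mem_unitDisk_iff.1 hz)
    rw [norm_mul] at schwarz
    exact (mul_le_iff_le_one_right (norm_pos_iff.2 hz0)).1 schwarz

theorem exists_schur_of_mem_classF (hα : α < 1) (hf : f ∈ classF α) :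
    ∃ φ : ℂ → ℂ, DifferentiableOn ℂ φ unitDisk ∧ (∀ z ∈ unitDisk, ‖φ z‖ ≤ 1) ∧
      ∀ z ∈ unitDisk, logDeriv (deriv f) z * (1 - z * φ z) = 2 * (1 - α) * φ z := by
  obtain ⟨⟨hfd, -, -⟩, hf', hre⟩ := hf
  have hT := differentiableOn_logDeriv_deriv hfd hf'
  set T := logDeriv (deriv f)
  have hlt : ∀ z ∈ unitDisk, ‖z * T z‖ < ‖((2 * (1 - α) : ℝ) : ℂ) + z * T z‖ :=
    fun z hz => (lt_re_one_add_iff hα).1 (hre z hz)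
  set b : ℂ := ((2 * (1 - α) : ℝ) : ℂ) with hb
  have hden : ∀ z ∈ unitDisk, b + z * T z ≠ 0 := fun z hz =>
    norm_pos_iff.1 ((norm_nonneg _).trans_lt (hlt z hz))
  have hφ : DifferentiableOn ℂ (fun z => T z / (b + z * T z)) unitDisk :=
    hT.div ((differentiableOn_id.mul hT).const_add _) hden
  refine ⟨_, hφ, fun z => norm_le_one_of_norm_mul_lt_one hφ fun w hw => ?_, fun z hz => ?_⟩
  · rw [mul_div_assoc', norm_div, div_lt_one (norm_pos_iff.2 (hden w hw))]
    exact hlt w hw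
  · have := hden z hz
    have hb' : 2 * (1 - (α : ℂ)) = b := by rw [hb]; push_cast; rfl
    rw [hb', mul_div_assoc', one_sub_div this, add_sub_cancel_right]
    ring

theorem exists_mem_classF_of_schur (hα : α < 1) (hφ : DifferentiableOn ℂ φ unitDisk)
    (hle : ∀ z ∈ unitDisk, ‖φ z‖ ≤ 1) :
    ∃ f ∈ classF α,
      ∀ z ∈ unitDisk, logDeriv (deriv f) z * (1 - z * φ z) = 2 * (1 - α) * φ z := by
  have h0 : (0 : ℂ) ∈ unitDisk := by simp [unitDisk]
  have hden : ∀ z ∈ unitDisk, 1 - z * φ z ≠ 0 := fun z hz => one_sub_mul_ne_zero hz (hle z hz)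
  have hT : DifferentiableOn ℂ (fun z => 2 * (1 - α) * φ z / (1 - z * φ z)) unitDisk :=
    (hφ.const_mul _).div ((differentiableOn_id.mul hφ).const_sub 1) hden
  obtain ⟨P, hP0, hP⟩ := hT.isExactOn_ball.with_val_at 0 0
  have hexp : DifferentiableOn ℂ (fun z => Complex.exp (P z)) unitDisk := fun z hz =>
    (hP z hz).cexp.differentiableAt.differentiableWithinAt
  obtain ⟨f, hf0, hf⟩ := hexp.isExactOn_ball.with_val_at 0 0
  have deriv_f : ∀ z ∈ unitDisk, deriv f z = Complex.exp (P z) := fun z hz => (hf z hz).deriv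
  have logDeriv_f : ∀ z ∈ unitDisk,
      logDeriv (deriv f) z = 2 * (1 - α) * φ z / (1 - z * φ z) := fun z hz => by
    have heq : deriv f =ᶠ[𝓝 z] fun w => Complex.exp (P w) :=
      eventually_of_mem (isOpen_unitDisk.mem_nhds hz) deriv_f
    rw [logDeriv_apply, heq.deriv_eq, (hP z hz).cexp.deriv, deriv_f z hz,
      mul_div_cancel_left₀ _ (Complex.exp_ne_zero _)]
  refine ⟨f, ⟨⟨fun z hz => (hf z hz).differentiableAt.differentiableWithinAt, hf0,
    by rw [deriv_f 0 h0, hP0, Complex.exp_zero]⟩,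
    fun z hz => by rw [deriv_f z hz]; exact Complex.exp_ne_zero _,
    fun z hz => (lt_re_one_add_iff hα).2 ?_⟩,
    fun z hz => by rw [logDeriv_f z hz, div_mul_cancel₀ _ (hden z hz)]⟩
  have hb : 0 < ‖2 * (1 - (α : ℂ))‖ := by
    rw [norm_pos_iff]
    exact_mod_cast (by linarith : 0 < 2 * (1 - α)).ne'
  have norm_lt : ‖2 * (1 - (α : ℂ))‖ * ‖z * φ z‖ < ‖2 * (1 - (α : ℂ))‖ :=
    mul_lt_of_lt_one_right hb (norm_mul_lt_one_of_mem_unitDisk hz (hle z hz))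
  have lhs_eq : z * logDeriv (deriv f) z = 2 * (1 - α) * (z * φ z) / (1 - z * φ z) := by
    rw [logDeriv_f z hz]; ring
  have rhs_eq : ((2 * (1 - α) : ℝ) : ℂ) + z * logDeriv (deriv f) z =
      2 * (1 - α) / (1 - z * φ z) := by
    rw [lhs_eq, add_div' _ _ _ (hden z hz)]; push_cast; ring
  rw [rhs_eq, lhs_eq, norm_div, norm_div, norm_mul]
  exact div_lt_div_of_pos_right norm_lt (norm_pos_iff.2 (hden z hz))

-- Differentiate `hrel`; the terms with a factor `z` cancel.
theorem schwarzian_mul_sq_of_schur (hfd : DifferentiableOn ℂ f unitDisk)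
    (hf' : ∀ z ∈ unitDisk, deriv f z ≠ 0) (hφ : DifferentiableOn ℂ φ unitDisk)
    (hrel : ∀ z ∈ unitDisk, logDeriv (deriv f) z * (1 - z * φ z) = 2 * (1 - α) * φ z)
    (hz : z ∈ unitDisk) :
    schwarzian f z * (1 - z * φ z) ^ 2 = 2 * (1 - α) * (deriv φ z + α * φ z ^ 2) := by
  have hnhds := isOpen_unitDisk.mem_nhds hz
  have hTz := (differentiableOn_logDeriv_deriv hfd hf').hasDerivAt hnhds
  have hφz := hφ.hasDerivAt hnhds
  have hrel' := (hTz.fun_mul (((hasDerivAt_id' z).fun_mul hφz).const_sub 1)).unique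
    ((hφz.const_mul (2 * (1 - (α : ℂ)))).congr_of_eventuallyEq (eventually_of_mem hnhds hrel))
  rw [schwarzian]
  linear_combination (1 - z * φ z) * hrel' + (φ z + z * deriv φ z) * hrel z hz -
    (logDeriv (deriv f) z * (1 - z * φ z) + 2 * (1 - α) * φ z) / 2 * hrel z hz

theorem sq_sub_sq_add_mul_add_sq_le {a X Y : ℝ} (ha : a < 1) :
    X ^ 2 - Y ^ 2 + a * (X + Y) ^ 2 ≤ X ^ 2 / (1 - a) := by
  rw [le_div_iff₀ (sub_pos.2 ha)]
  linarith [sq_nonneg (a * X - (1 - a) * Y)]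

-- With `X = 1 - r s` and `y = s - r`, `(1 - r²)(1 - s²) = X² - y²` and `(1 - r²) s = r X + y`.
theorem one_sub_sq_sq_mul_le {a r s p : ℝ} (ha : 0 ≤ a) (ha1 : a < 1) (hr : 0 ≤ r) (hr1 : r < 1)
    (hs1 : s ≤ 1) (hp : p * (1 - r ^ 2) ≤ 1 - s ^ 2) :
    (1 - r ^ 2) ^ 2 * (p + a * s ^ 2) ≤ (1 - r * s) ^ 2 / (1 - a) := by
  have hX : 0 ≤ 1 - r * s := by nlinarith
  have hr2 : 0 ≤ 1 - r ^ 2 := by nlinarith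
  have habs : |r * (1 - r * s) + (s - r)| ≤ (1 - r * s) + |s - r| := by
    refine (abs_add_le _ _).trans (add_le_add_left ?_ _)
    rw [abs_of_nonneg (mul_nonneg hr hX)]
    exact mul_le_of_le_one_left hX hr1.le
  calc (1 - r ^ 2) ^ 2 * (p + a * s ^ 2)
      = (1 - r ^ 2) * (p * (1 - r ^ 2)) + a * |r * (1 - r * s) + (s - r)| ^ 2 := by
        rw [sq_abs]; ring
    _ ≤ (1 - r ^ 2) * (1 - s ^ 2) + a * ((1 - r * s) + |s - r|) ^ 2 := by gcongr
    _ = (1 - r * s) ^ 2 - |s - r| ^ 2 + a * ((1 - r * s) + |s - r|) ^ 2 := by rw [sq_abs]; ring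
    _ ≤ (1 - r * s) ^ 2 / (1 - a) := sq_sub_sq_add_mul_add_sq_le ha1

theorem norm_schwarzian_le (hα : -1 < α) (hα' : α ≤ 0) (hf : f ∈ classF α) (hz : z ∈ unitDisk) :
    (1 - ‖z‖ ^ 2) ^ 2 * ‖schwarzian f z‖ ≤ 2 * ((1 - α) / (1 + α)) := by
  obtain ⟨φ, hφ, hφle, hrel⟩ := exists_schur_of_mem_classF (by linarith) hf
  have hden := norm_pos_iff.2 (one_sub_mul_ne_zero hz (hφle z hz))
  have le_den : 1 - ‖z‖ * ‖φ z‖ ≤ ‖1 - z * φ z‖ := by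
    simpa using norm_sub_norm_le (1 : ℂ) (z * φ z)
  have num_nonneg : 0 ≤ 1 - ‖z‖ * ‖φ z‖ :=
    sub_nonneg.2 (mul_le_one₀ (mem_unitDisk_iff.1 hz).le (norm_nonneg _) (hφle z hz))
  have hα1 : 0 ≤ 2 * (1 - α) := by linarith
  have hα2 : 0 < 1 + α := by linarith
  have schwarzian_le : ‖schwarzian f z‖ * ‖1 - z * φ z‖ ^ 2 ≤
      2 * (1 - α) * (‖deriv φ z‖ + -α * ‖φ z‖ ^ 2) := by
    have hcoe : 2 * (1 - (α : ℂ)) = ((2 * (1 - α) : ℝ) : ℂ) := by push_cast; rfl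
    rw [← norm_pow, ← norm_mul, schwarzian_mul_sq_of_schur hf.1.1 hf.2.1 hφ hrel hz, norm_mul,
      hcoe, Complex.norm_of_nonneg hα1]
    refine mul_le_mul_of_nonneg_left ((norm_add_le _ _).trans_eq ?_) hα1
    rw [norm_mul, norm_pow, Complex.norm_real, Real.norm_of_nonpos hα']
  refine le_of_mul_le_mul_right ?_ (pow_pos hden 2)
  calc (1 - ‖z‖ ^ 2) ^ 2 * ‖schwarzian f z‖ * ‖1 - z * φ z‖ ^ 2
      = (1 - ‖z‖ ^ 2) ^ 2 * (‖schwarzian f z‖ * ‖1 - z * φ z‖ ^ 2) := mul_assoc ..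
    _ ≤ (1 - ‖z‖ ^ 2) ^ 2 * (2 * (1 - α) * (‖deriv φ z‖ + -α * ‖φ z‖ ^ 2)) := by gcongr
    _ = 2 * (1 - α) * ((1 - ‖z‖ ^ 2) ^ 2 * (‖deriv φ z‖ + -α * ‖φ z‖ ^ 2)) := mul_left_comm ..
    _ ≤ 2 * (1 - α) * ((1 - ‖z‖ * ‖φ z‖) ^ 2 / (1 - -α)) := by
        gcongr
        exact one_sub_sq_sq_mul_le (by linarith) (by linarith) (norm_nonneg z)
          (mem_unitDisk_iff.1 hz) (hφle z hz) (norm_deriv_mul_le_of_norm_le_one hφ hφle hz)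
    _ ≤ 2 * (1 - α) * (‖1 - z * φ z‖ ^ 2 / (1 - -α)) := by rw [sub_neg_eq_add]; gcongr
    _ = 2 * ((1 - α) / (1 + α)) * ‖1 - z * φ z‖ ^ 2 := by rw [sub_neg_eq_add]; ring

-- For `α ≤ 0` the sign of `deriv φ r` makes the two terms of `deriv φ r + α * φ r ^ 2` add up.
theorem exists_mem_classF_norm_schwarzian_mul_eq (hα : α < 1) {r s : ℝ} (hr : (r : ℂ) ∈ unitDisk)
    (hs : (s : ℂ) ∈ unitDisk) :
    ∃ f ∈ classF α, (1 - r ^ 2) ^ 2 * ‖schwarzian f r‖ * (1 - r * s) ^ 2 =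
      2 * (1 - α) * |(1 - r ^ 2) * (1 - s ^ 2) - α * ((1 - r ^ 2) * s) ^ 2| := by
  obtain ⟨φ, hφ, hmaps, hφr, hderiv⟩ := exists_mapsTo_unitDisk_deriv_mul_eq hr hs
  obtain ⟨f, hf, hrel⟩ :=
    exists_mem_classF_of_schur hα hφ fun w hw => (mem_unitDisk_iff.1 (hmaps hw)).le
  have hS := schwarzian_mul_sq_of_schur hf.1.1 hf.2.1 hφ hrel hr
  rw [hφr] at hS
  rw [Complex.conj_ofReal, Complex.conj_ofReal] at hderiv
  have identity : schwarzian f r * (((1 - r ^ 2) * (1 - r * s) : ℝ) : ℂ) ^ 2 =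
      ((-(2 * (1 - α) * ((1 - r ^ 2) * (1 - s ^ 2) - α * ((1 - r ^ 2) * s) ^ 2)) : ℝ) : ℂ) := by
    push_cast
    linear_combination (1 - r ^ 2 : ℂ) ^ 2 * hS + 2 * (1 - α) * (1 - r ^ 2 : ℂ) * hderiv
  have hnorm := congrArg norm identity
  rw [norm_mul, norm_pow, Complex.norm_real, Complex.norm_real, Real.norm_eq_abs, sq_abs, norm_neg,
    norm_mul, Real.norm_of_nonneg (by linarith : 0 ≤ 2 * (1 - α)), Real.norm_eq_abs] at hnorm
  exact ⟨f, hf, by rw [← hnorm]; ring⟩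

theorem exists_mem_classF_norm_schwarzian_eq (hα : α < 1) {r v : ℝ} (hr : (r : ℂ) ∈ unitDisk)
    (hv : (v : ℂ) ∈ unitDisk) :
    ∃ f ∈ classF α, (1 - ‖(r : ℂ)‖ ^ 2) ^ 2 * ‖schwarzian f r‖ =
      2 * (1 - α) * |1 - v ^ 2 - α * (r + v) ^ 2| := by
  set s := (r + v) / (1 + r * v) with hs
  have s_mem : (s : ℂ) ∈ unitDisk := by
    simpa [hs, diskAut, mul_comm (v : ℂ)] using diskAut_mem_unitDisk (neg_mem_unitDisk hv) hr
  have hrv : 1 + r * v ≠ 0 := by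
    have := one_sub_conj_mul_ne_zero (neg_mem_unitDisk hv) hr
    simp only [map_neg, Complex.conj_ofReal, neg_mul, sub_neg_eq_add, mul_comm (v : ℂ)] at this
    exact_mod_cast this
  have hr2 : 0 < 1 - r ^ 2 := by simpa [Complex.norm_real] using one_sub_normSq_pos hr
  have one_sub_mul : 1 - r * s = (1 - r ^ 2) / (1 + r * v) := by rw [hs]; field_simp; ring
  have numerator : (1 - r ^ 2) * (1 - s ^ 2) - α * ((1 - r ^ 2) * s) ^ 2 =
      (1 - r * s) ^ 2 * (1 - v ^ 2 - α * (r + v) ^ 2) := by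
    rw [one_sub_mul, hs]; field_simp; ring
  obtain ⟨f, hf, hS⟩ := exists_mem_classF_norm_schwarzian_mul_eq hα hr s_mem
  have hpos : 0 < (1 - r * s) ^ 2 := by rw [one_sub_mul]; positivity
  rw [numerator, abs_mul, abs_of_pos hpos] at hS
  refine ⟨f, hf, mul_right_cancel₀ hpos.ne' ?_⟩
  rw [Complex.norm_real, Real.norm_eq_abs, sq_abs, hS]
  ring

theorem exists_mem_classF_lt_norm_schwarzian (hα : -1 / 2 ≤ α) (hα' : α ≤ 0) {m : ℝ}
    (hm : m < 2 * ((1 - α) / (1 + α))) :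
    ∃ f ∈ classF α, ∃ z ∈ unitDisk, m < (1 - ‖z‖ ^ 2) ^ 2 * ‖schwarzian f z‖ := by
  have hα1 : 0 < 1 + α := by linarith
  -- This `v` maximizes `1 - v ^ 2 - α * (1 + v) ^ 2`.
  set v := -α / (1 + α) with hv
  have hv0 : 0 ≤ v := div_nonneg (neg_nonneg.2 hα') hα1.le
  have hv1 : v ≤ 1 := (div_le_one hα1).2 (by linarith)
  have value_lim : Tendsto (fun t : ℝ => 2 * (1 - α) * (1 - (t * v) ^ 2 - α * (t + t * v) ^ 2))
      (𝓝[<] 1) (𝓝 (2 * ((1 - α) / (1 + α)))) := by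
    have : 2 * ((1 - α) / (1 + α)) =
        2 * (1 - α) * (1 - (1 * v) ^ 2 - α * (1 + 1 * v) ^ 2) := by
      rw [hv]; field_simp; ring
    rw [this]
    exact (Continuous.tendsto (by fun_prop) 1).mono_left nhdsWithin_le_nhds
  obtain ⟨t, hmt, ht0, ht1⟩ :=
    ((value_lim.eventually_const_lt hm).and (Ioo_mem_nhdsLT (zero_lt_one' ℝ))).exists
  have ht : (t : ℂ) ∈ unitDisk := by
    rwa [mem_unitDisk_iff, Complex.norm_of_nonneg ht0.le]
  have htv : ((t * v : ℝ) : ℂ) ∈ unitDisk := by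
    rw [mem_unitDisk_iff, Complex.norm_of_nonneg (by positivity)]
    exact mul_lt_one_of_nonneg_of_lt_one_left ht0.le ht1 hv1
  obtain ⟨f, hf, hS⟩ := exists_mem_classF_norm_schwarzian_eq (by linarith : α < 1) ht htv
  refine ⟨f, hf, t, ht, hmt.trans_le ?_⟩
  rw [hS]
  gcongr
  · linarith
  · exact le_abs_self _

end ClassF

theorem mainTheorem6 (α : ℝ) (hα : -1 / 2 ≤ α) (hα' : α < 0) :
    -- the two bounds
    (∀ f ∈ classF α, ∀ z₁ ∈ unitDisk, ∀ z₂ ∈ unitDisk,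
      (hypDist z₁ z₂ ≤ Real.pi * √((1 + α) / (-2 * α)) →
        √((1 + α) / (-2 * α)) * Real.sin (√(-2 * α / (1 + α)) * hypDist z₁ z₂)
          ≤ twoPointDistortion f z₁ z₂) ∧
      twoPointDistortion f z₁ z₂
        ≤ √((1 + α) / 2) * Real.sinh (√(2 / (1 + α)) * hypDist z₁ z₂)) ∧
    -- sharpness of the lower bound: no smaller constant will do, even for close points
    (∀ δ : ℝ, 0 < δ → δ < √(-2 * α / (1 + α)) → ∀ ε : ℝ, 0 < ε →
      ∃ f ∈ classF α, ∃ z₁ ∈ unitDisk, ∃ z₂ ∈ unitDisk, hypDist z₁ z₂ < ε ∧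
        twoPointDistortion f z₁ z₂ < 1 / δ * Real.sin (δ * hypDist z₁ z₂)) ∧
    -- sharpness of the upper bound: no smaller constant will do, even for close points
    (∀ κ : ℝ, 0 < κ → κ < √(2 / (1 + α)) → ∀ ε : ℝ, 0 < ε →
      ∃ f ∈ classF α, ∃ z₁ ∈ unitDisk, ∃ z₂ ∈ unitDisk, hypDist z₁ z₂ < ε ∧
        1 / κ * Real.sinh (κ * hypDist z₁ z₂) < twoPointDistortion f z₁ z₂) := by
  have hα1 : 0 < 1 + α := by linarith
  have hδ₀ : 0 < -2 * α / (1 + α) := div_pos (by linarith) hα1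
  have hκ₀ : 0 < 2 / (1 + α) := by positivity
  have norm_eq_δ : (1 - α) / (1 + α) = 1 + -2 * α / (1 + α) := by field_simp; ring
  have norm_eq_κ : (1 - α) / (1 + α) = 2 / (1 + α) - 1 := by field_simp; ring
  rw [← inv_div, Real.sqrt_inv, ← inv_div 2, Real.sqrt_inv]
  refine ⟨fun f hf z₁ hz₁ z₂ hz₂ => ⟨fun hπ => ?_, ?_⟩, fun δ hδ hδlt ε hε => ?_,
    fun κ hκ hκlt ε hε => ?_⟩
  · refine sin_le_twoPointDistortion hf.1.1 hf.2.1 (Real.sqrt_pos.2 hδ₀) (fun z hz => ?_) hz₁ hz₂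
      ((le_mul_inv_iff₀' (Real.sqrt_pos.2 hδ₀)).1 hπ)
    rw [Real.sq_sqrt hδ₀.le, ← norm_eq_δ]
    exact norm_schwarzian_le (by linarith) hα'.le hf hz
  · refine twoPointDistortion_le_sinh hf.1.1 hf.2.1 (Real.sqrt_pos.2 hκ₀) (fun z hz => ?_) hz₁ hz₂
    rw [Real.sq_sqrt hκ₀.le, ← norm_eq_κ]
    exact norm_schwarzian_le (by linarith) hα'.le hf hz
  · obtain ⟨f, hf, z₁, hz₁, hS⟩ := exists_mem_classF_lt_norm_schwarzian hα hα'.le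
      (m := 2 * (1 + δ ^ 2)) (by linarith [(Real.lt_sqrt hδ.le).1 hδlt])
    exact ⟨f, hf, z₁, hz₁, exists_twoPointDistortion_lt_sin hf.1.1 hf.2.1 hδ hz₁ hS hε⟩
  · obtain ⟨f, hf, z₁, hz₁, hS⟩ := exists_mem_classF_lt_norm_schwarzian hα hα'.le
      (m := 2 * (κ ^ 2 - 1)) (by linarith [(Real.lt_sqrt hκ.le).1 hκlt])
    exact ⟨f, hf, z₁, hz₁, exists_sinh_lt_twoPointDistortion hf.1.1 hf.2.1 hκ hz₁ hS hε⟩
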